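/- For a nonempty compact convex set $K\subset\mathbb{R}^2$ let $h_K(\theta)=\max\{x\cdot e^{i\theta}:x\in K\}$, with $e^{i\theta}=(\cos\theta,\sin\theta)$, be its support function, a $2\pi$-periodic Lipschitz function. Let $s(K)=\frac1\pi\int_0^{2\pi}h_K(\theta)e^{i\theta}\,d\theta$ be its Steiner point and $P(K)=\int_0^{2\pi}h_K\,d\theta$ its perimeter (for a line segment this is twice its length). Let $$\mathcal{A}=\{K\subset\mathbb{R}^2 \text{ nonempty, compact, convex}: s(K)=0,\ P(K)=2\pi\},$$ with the topology of the Hausdorff distance. Let $a,b,c,d$ be (essentially) bounded measurable real functions on $(0,2\pi)$ with $a,b\ge 0$ almost everywhere, and suppose that $a>0$ almost everywhere or $b>0$ almost everywhere. Put $$J(K)=\int_0^{2\pi}\left(a\,h_K^2+b\,{h_K'}^2+c\,h_K+d\,h_K'\right)d\theta .$$ (1) Every local maximizer $K$ of $J$ within $\mathcal{A}$ is either a (nondegenerate) triangle or a line segment, and the support, in the circle $\mathbb{R}/2\pi\mathbb{Z}$, of the distribution $h_K''+h_K$ has at most three points. (2) The two conclusions in (1) are equivalent: a set $K\in\mathcal{A}$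 is a triangle or a line segment if and only if the support of $h_K''+h_K$ has at most three points. -/

import Mathlib

open MeasureTheory Set Topology TopologicalSpace
open scoped Real ContDiff ENNReal

noncomputable section

/-- The Euclidean plane. -/
abbrev Plane : Type := EuclideanSpace ℝ (Fin 2)

/-- The unit vector `e^{iθ} = (cos θ, sin θ)`. -/
def unitVec (θ : ℝ) : Plane := !₂[Real.cos θ, Real.sin θ]

/-- The support function `h_K(θ) = max {x · e^{iθ} : x ∈ K}` of a nonempty compact set
(the supremum is attained). -/
def supportFn (K : NonemptyCompacts Plane) (θ : ℝ) : ℝ :=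
  sSup ((fun x : Plane => inner ℝ x (unitVec θ)) '' (K : Set Plane))

/-- The Steiner point `s(K) = (1/π) ∫₀^{2π} h_K(θ) e^{iθ} dθ`. -/
def steinerPoint (K : NonemptyCompacts Plane) : Plane :=
  (1 / π) • ∫ θ in (0 : ℝ)..(2 * π), supportFn K θ • unitVec θ

/-- The perimeter `P(K) = ∫₀^{2π} h_K dθ` of a compact convex set (Cauchy's formula). It is the
length of the boundary if `K` has interior points, and twice the length if `K` is a segment. -/
def perimeter (K : NonemptyCompacts Plane) : ℝ :=
  ∫ θ in (0 : ℝ)..(2 * π), supportFn K θ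

/-- The class `𝒜` of (nonempty, compact) convex sets in the plane with Steiner point at the
origin and perimeter `2π`. -/
def classA : Set (NonemptyCompacts Plane) :=
  {K | Convex ℝ (K : Set Plane) ∧ steinerPoint K = 0 ∧ perimeter K = 2 * π}

/-- The functional `J(K) = ∫₀^{2π} (a h_K² + b h_K'² + c h_K + d h_K') dθ`. The support function
is Lipschitz, so that `deriv` is its derivative at almost every point, and is also its weak
derivative. -/
def functionalJ (a b c d : ℝ → ℝ) (K : NonemptyCompacts Plane) : ℝ :=
  ∫ θ in (0 : ℝ)..(2 * π),
    (a θ * supportFn K θ ^ 2 + b θ * deriv (supportFn K) θ ^ 2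
      + c θ * supportFn K θ + d θ * deriv (supportFn K) θ)

/-- `K` is a (nondegenerate) line segment. -/
def IsLineSegment (K : Set Plane) : Prop :=
  ∃ p q : Plane, p ≠ q ∧ K = segment ℝ p q

/-- `K` is a (nondegenerate, filled) triangle. -/
def IsTriangle (K : Set Plane) : Prop :=
  ∃ p : Fin 3 → Plane, AffineIndependent ℝ p ∧ K = convexHull ℝ (range p)

/-- The support, in the circle `ℝ / 2πℤ`, of the distribution `h'' + h`, for a `2π`-periodic
function `h`. A smooth function `φ` on the circle (that is, a `2π`-periodic smooth function on
the line) is mapped by this distribution to `∫₀^{2π} h (φ'' + φ) dθ`; a point belongs to the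
support iff the distribution vanishes on no neighbourhood of it. -/
def curvatureSupport (h : ℝ → ℝ) : Set (AddCircle (2 * π)) :=
  {x | ∀ U ∈ 𝓝 x, ∃ φ : ℝ → ℝ, ContDiff ℝ ∞ φ ∧ Function.Periodic φ (2 * π) ∧
    tsupport φ ⊆ (fun θ : ℝ => (θ : AddCircle (2 * π))) ⁻¹' U ∧
    ∫ θ in (0 : ℝ)..(2 * π), h θ * (iteratedDeriv 2 φ θ + φ θ) ≠ 0}

end

/-!
Write `h` for the support function of `K` and `μ = h'' + h` for its curvature measure on the
circle.

*Local maximizers have at most three points of curvature.* If the support of `μ` has four points,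
there is a smooth function `φ`, a combination of four bumps near these points, with `φ μ ≠ 0`
orthogonal to the three functions `1`, `cos`, `sin` (`exists_density`). Orthogonality to `cos` and
`sin` makes `v'' + v = φ μ` solvable on the circle; `v` can be chosen with zero Steiner point, and
orthogonality to `1` says that `∫ v = 0`. For small `|t|` the function `h + t v` has the
nonnegative curvature `(1 + t φ) μ`, so it is the support function of a member of `𝒜` close to `K`
(`exists_perturbation`). The quadratic part of `J` is positive definite on functions with zero mean,
so `J` is strictly convex along this segment (`two_mul_functionalJ_lt`) and `K` is not a local
maximizer.

No measure is ever constructed. The solution `v` is given by an explicit formula in `h` without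
derivatives (`curvatureMul`), and nonnegative curvature is expressed by a three-point inequality
(`TrigConvex`) which implies being a support function (`TrigConvex.exists_supportFn_eq`). The
inequality for `h + t v` is elementary when `h` is smooth, and it passes to the limit along
mollifications of `h` (`trigConvex_curvatureMul`).

*At most three points of curvature means triangle or segment.* Off the support of `μ` the
mollifications of `h` solve `m'' + m = 0`, so on each of the three complementary arcs `h` is the
support function of one point, which belongs to `K`; hence `K` is the convex hull of three points
(`exists_convexHull_range_eq_of_encard_le_three`). Conversely a direction in the support of `μ` is
one in which two vertices are extreme (`exists_tie_of_mem_curvatureSupport`), that is, an outer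
normal of a side.
-/

noncomputable section

/-! ### Unit vectors and support functions -/

theorem inner_unitVec (x : Plane) (θ : ℝ) :
    inner ℝ x (unitVec θ) = x 0 * Real.cos θ + x 1 * Real.sin θ := by
  simp [unitVec, PiLp.inner_apply, Fin.sum_univ_two, mul_comm]

theorem unitVec_add_two_pi (θ : ℝ) : unitVec (θ + 2 * π) = unitVec θ := by
  simp [unitVec]

theorem norm_unitVec (θ : ℝ) : ‖unitVec θ‖ = 1 := by
  simp [unitVec, EuclideanSpace.norm_eq]

theorem norm_sq_plane (x : Plane) : ‖x‖ ^ 2 = x 0 ^ 2 + x 1 ^ 2 := by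
  simp [EuclideanSpace.norm_sq_eq, Fin.sum_univ_two]

theorem continuous_unitVec : Continuous unitVec := by
  unfold unitVec
  fun_prop

theorem exists_eq_norm_smul_unitVec (x : Plane) : ∃ θ, x = ‖x‖ • unitVec θ := by
  have h := norm_sq_plane x
  refine ⟨Complex.arg ⟨x 0, x 1⟩, ?_⟩
  have hn : ‖(⟨x 0, x 1⟩ : ℂ)‖ = ‖x‖ := by
    rw [← sq_eq_sq₀ (norm_nonneg _) (norm_nonneg _), h, ← Complex.normSq_eq_norm_sq,
      Complex.normSq_apply]
    ring
  have h0 := Complex.norm_mul_cos_arg (⟨x 0, x 1⟩ : ℂ)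
  have h1 := Complex.norm_mul_sin_arg (⟨x 0, x 1⟩ : ℂ)
  rw [hn] at h0 h1
  ext i
  fin_cases i
  · simp [unitVec, h0]
  · simp [unitVec, h1]

theorem norm_le_of_inner_unitVec_le {x : Plane} {M : ℝ}
    (h : ∀ θ, inner ℝ x (unitVec θ) ≤ M) : ‖x‖ ≤ M := by
  obtain ⟨θ, hθ⟩ := exists_eq_norm_smul_unitVec x
  have := h θ
  rw [hθ, real_inner_smul_left, real_inner_self_eq_norm_sq, norm_unitVec] at this
  simpa using this

theorem bddAbove_supportFn (K : NonemptyCompacts Plane) (θ : ℝ) :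
    BddAbove ((fun x : Plane => inner ℝ x (unitVec θ)) '' (K : Set Plane)) :=
  (K.isCompact.image (by fun_prop)).bddAbove

theorem inner_le_supportFn {K : NonemptyCompacts Plane} {x : Plane} (hx : x ∈ (K : Set Plane))
    (θ : ℝ) : inner ℝ x (unitVec θ) ≤ supportFn K θ :=
  le_csSup (bddAbove_supportFn K θ) ⟨x, hx, rfl⟩

theorem exists_inner_eq_supportFn (K : NonemptyCompacts Plane) (θ : ℝ) :
    ∃ x ∈ (K : Set Plane), inner ℝ x (unitVec θ) = supportFn K θ :=
  (K.isCompact.image (f := fun x : Plane => inner ℝ x (unitVec θ)) (by fun_prop)).sSup_mem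
    (K.nonempty.image _)

theorem supportFn_le_iff {K : NonemptyCompacts Plane} {θ r : ℝ} :
    supportFn K θ ≤ r ↔ ∀ x ∈ (K : Set Plane), inner ℝ x (unitVec θ) ≤ r := by
  refine ⟨fun h x hx => (inner_le_supportFn hx θ).trans h, fun h => ?_⟩
  obtain ⟨x, hx, he⟩ := exists_inner_eq_supportFn K θ
  exact he ▸ h x hx

theorem supportFn_periodic (K : NonemptyCompacts Plane) :
    Function.Periodic (supportFn K) (2 * π) := fun θ => by
  simp only [supportFn, unitVec_add_two_pi]

theorem norm_unitVec_sub_le (θ θ' : ℝ) : ‖unitVec θ - unitVec θ'‖ ≤ |θ - θ'| := by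
  rw [← abs_of_nonneg (norm_nonneg (unitVec θ - unitVec θ')), ← sq_le_sq, norm_sq_plane]
  have h1 := Real.one_sub_sq_div_two_le_cos (x := θ - θ')
  rw [Real.cos_sub] at h1
  have h2 := Real.sin_sq_add_cos_sq θ
  have h3 := Real.sin_sq_add_cos_sq θ'
  simp only [unitVec, PiLp.sub_apply, Matrix.cons_val_zero, Matrix.cons_val_one]
  nlinarith

theorem exists_lipschitzWith_supportFn (K : NonemptyCompacts Plane) :
    ∃ C, LipschitzWith C (supportFn K) := by
  obtain ⟨R, hR⟩ := K.isCompact.isBounded.exists_norm_le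
  have hR0 : 0 ≤ R := by
    obtain ⟨x, hx⟩ := K.nonempty
    exact (norm_nonneg x).trans (hR x hx)
  refine ⟨_, LipschitzWith.of_le_add_mul' R fun θ θ' => ?_⟩
  rw [supportFn_le_iff]
  intro x hx
  have h1 := inner_le_supportFn hx θ'
  have h2 : inner ℝ x (unitVec θ - unitVec θ') ≤ R * |θ - θ'| :=
    (real_inner_le_norm _ _).trans
      (mul_le_mul (hR x hx) (norm_unitVec_sub_le θ θ') (norm_nonneg _) hR0)
  rw [inner_sub_right] at h2
  rw [Real.dist_eq]
  linarith

theorem continuous_supportFn (K : NonemptyCompacts Plane) : Continuous (supportFn K) := by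
  obtain ⟨C, hC⟩ := exists_lipschitzWith_supportFn K
  exact hC.continuous

/-- Sublinearity of the support function, applied to
`e^{i(θ+s)} + e^{i(θ-s)} = 2 cos s · e^{iθ}`. -/
theorem two_cos_mul_supportFn_le (K : NonemptyCompacts Plane) (θ s : ℝ) :
    2 * Real.cos s * supportFn K θ ≤ supportFn K (θ + s) + supportFn K (θ - s) := by
  obtain ⟨x, hx, he⟩ := exists_inner_eq_supportFn K θ
  have h1 := inner_le_supportFn hx (θ + s)
  have h2 := inner_le_supportFn hx (θ - s)
  rw [← he]
  simp only [inner_unitVec, Real.cos_add, Real.sin_add, Real.cos_sub, Real.sin_sub] at *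
  linarith

/-- The nearest point of `K` gives a separating direction, so that support functions control
distances to convex sets. -/
theorem exists_mem_dist_le_of_inner_le {K : NonemptyCompacts Plane} (hK : Convex ℝ (K : Set Plane))
    {x : Plane} {r : ℝ} (hr : 0 ≤ r) (h : ∀ θ, inner ℝ x (unitVec θ) ≤ supportFn K θ + r) :
    ∃ y ∈ (K : Set Plane), dist x y ≤ r := by
  obtain ⟨y, hy, hmin⟩ :=
    exists_norm_eq_iInf_of_complete_convex K.nonempty K.isCompact.isComplete hK x
  rw [norm_eq_iInf_iff_real_inner_le_zero hK hy] at hmin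
  refine ⟨y, hy, ?_⟩
  rw [dist_eq_norm]
  obtain ⟨θ, hθ⟩ := exists_eq_norm_smul_unitVec (x - y)
  rcases (norm_nonneg (x - y)).eq_or_lt with h0 | h0
  · rwa [← h0]
  · have h1 : supportFn K θ ≤ inner ℝ y (unitVec θ) := by
      rw [supportFn_le_iff]
      intro z hz
      have := hmin z hz
      rw [hθ, real_inner_smul_left, real_inner_comm, inner_sub_left] at this
      have := nonpos_of_mul_nonpos_right this h0
      linarith
    have h2 : inner ℝ (x - y) (unitVec θ) = ‖x - y‖ := by
      rw [hθ, real_inner_smul_left, real_inner_self_eq_norm_sq, norm_unitVec, norm_smul,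
        norm_unitVec]
      simp
    rw [inner_sub_left] at h2
    linarith [h θ]

theorem mem_of_inner_le_supportFn {K : NonemptyCompacts Plane} (hK : Convex ℝ (K : Set Plane))
    {x : Plane} (h : ∀ θ, inner ℝ x (unitVec θ) ≤ supportFn K θ) : x ∈ (K : Set Plane) := by
  obtain ⟨y, hy, hxy⟩ := exists_mem_dist_le_of_inner_le hK le_rfl (x := x) (by simpa using h)
  rwa [dist_le_zero.1 hxy]

theorem dist_le_of_supportFn_le {K L : NonemptyCompacts Plane} (hK : Convex ℝ (K : Set Plane))
    (hL : Convex ℝ (L : Set Plane)) {r : ℝ} (hr : 0 ≤ r)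
    (h : ∀ θ, |supportFn K θ - supportFn L θ| ≤ r) : dist K L ≤ r := by
  rw [Metric.NonemptyCompacts.dist_eq]
  refine Metric.hausdorffDist_le_of_mem_dist hr (fun x hx => ?_) (fun x hx => ?_)
  · exact exists_mem_dist_le_of_inner_le hL hr fun θ => by
      linarith [inner_le_supportFn hx θ, (abs_le.1 (h θ)).2]
  · exact exists_mem_dist_le_of_inner_le hK hr fun θ => by
      linarith [inner_le_supportFn hx θ, (abs_le.1 (h θ)).1]

/-! ### Reconstructing a convex set from its support function -/

/-- The inequality `g(θ) sin(s+s') ≤ g(θ+s) sin s' + g(θ-s') sin s` for `s, s' ∈ [0, π]`, which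
characterises support functions among continuous `2π`-periodic functions. It is a form of
`g'' + g ≥ 0` that involves no derivative and therefore survives pointwise limits. -/
def TrigConvex (g : ℝ → ℝ) : Prop :=
  ∀ θ s s' : ℝ, s ∈ Icc 0 π → s' ∈ Icc 0 π →
    g θ * Real.sin (s + s') ≤ g (θ + s) * Real.sin s' + g (θ - s') * Real.sin s

/-- The slope `m` of a trigonometric tangent of `g` at `θ` separates the slopes of the
trigonometric chords to the left of `θ` from those to the right. -/
theorem TrigConvex.exists_tangent {g : ℝ → ℝ} (hg : TrigConvex g) (θ : ℝ) :
    ∃ m, ∀ s, |s| ≤ π → g θ * Real.cos s + m * Real.sin s ≤ g (θ + s) := by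
  -- The slopes of the chords to the left of `θ`; the supremum of `A` is the slope sought.
  set A : Set ℝ := (fun s => (g θ * Real.cos s - g (θ - s)) / Real.sin s) '' Ioo 0 π
  have hAB : ∀ s ∈ Ioo 0 π, ∀ y ∈ A, y ≤ (g (θ + s) - g θ * Real.cos s) / Real.sin s := by
    rintro s hs _ ⟨s', hs', rfl⟩
    have h1 := Real.sin_pos_of_mem_Ioo hs
    have h2 := Real.sin_pos_of_mem_Ioo hs'
    have h3 := hg θ s s' (Ioo_subset_Icc_self hs) (Ioo_subset_Icc_self hs')
    rw [Real.sin_add] at h3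
    simp only
    rw [div_le_div_iff₀ h2 h1]
    nlinarith
  have hpi : π / 2 ∈ Ioo 0 π := ⟨by positivity, by linarith [Real.pi_pos]⟩
  have hne : A.Nonempty := ⟨_, mem_image_of_mem _ hpi⟩
  have hbdd : BddAbove A := ⟨_, hAB _ hpi⟩
  refine ⟨sSup A, fun s hs => ?_⟩
  -- At `s = ±π` the sine vanishes and the tangent inequality does not involve the slope.
  have hend : -g θ ≤ g (θ - π) ∧ -g θ ≤ g (θ + π) := by
    have h1 := hg θ (π / 2) π (Ioo_subset_Icc_self hpi) ⟨Real.pi_pos.le, le_rfl⟩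
    have h2 := hg θ π (π / 2) ⟨Real.pi_pos.le, le_rfl⟩ (Ioo_subset_Icc_self hpi)
    simp only [Real.sin_add] at h1 h2
    simp at h1 h2
    exact ⟨h1, h2⟩
  rw [abs_le] at hs
  rcases lt_trichotomy s 0 with h0 | h0 | h0
  · rcases hs.1.eq_or_lt with h | h
    · rw [← h]
      simpa [sub_eq_add_neg] using hend.1
    · have hm : -s ∈ Ioo 0 π := ⟨by linarith, by linarith⟩
      have h1 := le_csSup hbdd (mem_image_of_mem _ hm)
      rw [div_le_iff₀ (Real.sin_pos_of_mem_Ioo hm)] at h1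
      simp only [Real.sin_neg, Real.cos_neg, sub_neg_eq_add] at h1
      linarith
  · simp [h0]
  · rcases hs.2.eq_or_lt with h | h
    · rw [h]
      simpa using hend.2
    · have h1 := csSup_le hne (hAB s ⟨h0, h⟩)
      rw [le_div_iff₀ (Real.sin_pos_of_mem_Ioo ⟨h0, h⟩)] at h1
      linarith

theorem exists_abs_sub_zsmul_sub_le_pi (θ θ₀ : ℝ) : ∃ k : ℤ, |θ - k • (2 * π) - θ₀| ≤ π := by
  refine ⟨toIcoDiv Real.two_pi_pos (θ₀ - π) θ, ?_⟩
  have h := sub_toIcoDiv_zsmul_mem_Ico Real.two_pi_pos (θ₀ - π) θ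
  rw [abs_le]
  constructor <;> linarith [h.1, h.2]

theorem unitVec_sub_zsmul (θ : ℝ) (k : ℤ) : unitVec (θ - k • (2 * π)) = unitVec θ :=
  (show Function.Periodic unitVec (2 * π) from unitVec_add_two_pi).sub_zsmul_eq k

theorem TrigConvex.exists_supportFn_eq {g : ℝ → ℝ} (hg : TrigConvex g) (hc : Continuous g)
    (hp : Function.Periodic g (2 * π)) :
    ∃ K : NonemptyCompacts Plane, Convex ℝ (K : Set Plane) ∧ supportFn K = g := by
  set S : Set Plane := ⋂ θ : ℝ, {x : Plane | inner ℝ x (unitVec θ) ≤ g θ}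
  have hmem : ∀ x, x ∈ S ↔ ∀ θ, inner ℝ x (unitVec θ) ≤ g θ := fun x => by simp [S]
  have hattain : ∀ θ₀, ∃ x ∈ S, inner ℝ x (unitVec θ₀) = g θ₀ := by
    intro θ₀
    obtain ⟨m, hm⟩ := hg.exists_tangent θ₀
    have key : ∀ s, inner ℝ (g θ₀ • unitVec θ₀ + m • unitVec (θ₀ + π / 2)) (unitVec (θ₀ + s))
        = g θ₀ * Real.cos s + m * Real.sin s := by
      intro s
      have h := Real.sin_sq_add_cos_sq θ₀
      rw [inner_unitVec]
      simp only [unitVec, PiLp.add_apply, PiLp.smul_apply, smul_eq_mul, Matrix.cons_val_zero,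
        Matrix.cons_val_one, Real.cos_add, Real.sin_add, Real.cos_pi_div_two, Real.sin_pi_div_two]
      linear_combination (g θ₀ * Real.cos s + m * Real.sin s) * h
    refine ⟨_, (hmem _).2 fun θ => ?_, by simpa using key 0⟩
    obtain ⟨k, hk⟩ := exists_abs_sub_zsmul_sub_le_pi θ θ₀
    rw [← unitVec_sub_zsmul θ k, ← hp.sub_zsmul_eq k (x := θ)]
    have h1 := hm _ hk
    have h2 := key (θ - k • (2 * π) - θ₀)
    rw [add_sub_cancel] at h1 h2
    rw [h2]
    exact h1
  have hclosed : IsClosed S := isClosed_iInter fun θ =>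
    isClosed_le (by fun_prop) continuous_const
  obtain ⟨M, hM⟩ : ∃ M, ∀ θ, g θ ≤ M := by
    obtain ⟨M, hM⟩ := (hp.compact_of_continuous Real.two_pi_pos.ne' hc).bddAbove
    exact ⟨M, fun θ => hM ⟨θ, rfl⟩⟩
  have hcompact : IsCompact S := by
    refine Metric.isCompact_of_isClosed_isBounded hclosed
      (isBounded_iff_forall_norm_le.2 ⟨M, fun x hx => ?_⟩)
    exact norm_le_of_inner_unitVec_le fun θ => ((hmem x).1 hx θ).trans (hM θ)
  have hne : S.Nonempty := by
    obtain ⟨x, hx, -⟩ := hattain 0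
    exact ⟨x, hx⟩
  refine ⟨⟨⟨S, hcompact⟩, hne⟩, ?_, ?_⟩
  · refine convex_iInter fun θ x hx y hy a b ha hb hab => ?_
    simp only [mem_ofPred_eq, inner_add_left, real_inner_smul_left] at *
    calc a * inner ℝ x (unitVec θ) + b * inner ℝ y (unitVec θ) ≤ a * g θ + b * g θ := by gcongr
      _ = g θ := by rw [← add_mul, hab, one_mul]
  · funext θ
    refine le_antisymm (supportFn_le_iff.2 fun x hx => (hmem x).1 hx θ) ?_
    obtain ⟨x, hx, he⟩ := hattain θ
    rw [← he]
    exact inner_le_supportFn (K := ⟨⟨S, hcompact⟩, hne⟩) hx θ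

/-! ### Functions with `g'' + g ≥ 0` -/

/-- For `x` between `θ₀` and `θ₁` the derivative of `g'(x) sin(θ₁-x) + g(x) cos(θ₁-x)` is
`(g''(x) + g(x)) sin(θ₁-x)`. -/
theorem trigConvex_of_hasDerivAt {g g' g'' : ℝ → ℝ} (h1 : ∀ x, HasDerivAt g (g' x) x)
    (h2 : ∀ x, HasDerivAt g' (g'' x) x) (h : ∀ x, 0 ≤ g'' x + g x) : TrigConvex g := by
  have hW : ∀ θ₁ x, HasDerivAt (fun x => g' x * Real.sin (θ₁ - x) + g x * Real.cos (θ₁ - x))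
      ((g'' x + g x) * Real.sin (θ₁ - x)) x := by
    intro θ₁ x
    have hs := ((hasDerivAt_id x).const_sub θ₁).sin
    have hc := ((hasDerivAt_id x).const_sub θ₁).cos
    refine (((h2 x).mul hs).add ((h1 x).mul hc)).congr_deriv ?_
    simp only [id]
    ring
  have hWc : ∀ θ₁, Continuous fun x => g' x * Real.sin (θ₁ - x) + g x * Real.cos (θ₁ - x) :=
    fun θ₁ => continuous_iff_continuousAt.2 fun x => (hW θ₁ x).continuousAt
  have right : ∀ θ s, s ∈ Icc 0 π → g' θ * Real.sin s + g θ * Real.cos s ≤ g (θ + s) := by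
    intro θ s hs
    have hm := monotoneOn_of_deriv_nonneg (convex_Icc θ (θ + s)) (hWc (θ + s)).continuousOn
      (fun x _ => (hW (θ + s) x).differentiableAt.differentiableWithinAt) (fun x hx => ?_)
    · have := hm (left_mem_Icc.2 (by linarith [hs.1])) (right_mem_Icc.2 (by linarith [hs.1]))
        (by linarith [hs.1])
      simpa using this
    · rw [interior_Icc] at hx
      rw [(hW (θ + s) x).deriv]
      exact mul_nonneg (h x) (Real.sin_nonneg_of_nonneg_of_le_pi (by linarith [hx.2])
        (by linarith [hx.1, hs.2]))
  have left : ∀ θ s, s ∈ Icc 0 π → -g' θ * Real.sin s + g θ * Real.cos s ≤ g (θ - s) := by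
    intro θ s hs
    have hm := antitoneOn_of_deriv_nonpos (convex_Icc (θ - s) θ) (hWc (θ - s)).continuousOn
      (fun x _ => (hW (θ - s) x).differentiableAt.differentiableWithinAt) (fun x hx => ?_)
    · have := hm (left_mem_Icc.2 (by linarith [hs.1])) (right_mem_Icc.2 (by linarith [hs.1]))
        (by linarith [hs.1])
      simpa using this
    · rw [interior_Icc] at hx
      rw [(hW (θ - s) x).deriv]
      exact mul_nonpos_of_nonneg_of_nonpos (h x) (Real.sin_nonpos_of_nonpos_of_neg_pi_le
        (by linarith [hx.1]) (by linarith [hx.2, hs.2]))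
  intro θ s s' hs hs'
  have h3 := mul_le_mul_of_nonneg_right (right θ s hs) (Real.sin_nonneg_of_mem_Icc hs')
  have h4 := mul_le_mul_of_nonneg_right (left θ s' hs') (Real.sin_nonneg_of_mem_Icc hs)
  rw [Real.sin_add]
  nlinarith

theorem TrigConvex.of_tendsto {ι : Type*} {l : Filter ι} [l.NeBot] {G : ι → ℝ → ℝ} {g : ℝ → ℝ}
    (hG : ∀ᶠ i in l, TrigConvex (G i)) (h : ∀ θ, Filter.Tendsto (fun i => G i θ) l (𝓝 (g θ))) :
    TrigConvex g := fun θ s s' hs hs' =>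
  le_of_tendsto_of_tendsto ((h θ).mul_const _) (((h _).mul_const _).add ((h _).mul_const _))
    (hG.mono fun _ hi => hi θ s s' hs hs')

/-- The second derivative test at `s = 0` for `g(θ+s) + g(θ-s) - 2 cos s · g(θ)`, which is
nonnegative and vanishes to first order there. -/
theorem second_deriv_add_self_nonneg {g g' g'' : ℝ → ℝ} (h1 : ∀ x, HasDerivAt g (g' x) x)
    (h2 : ∀ x, HasDerivAt g' (g'' x) x)
    (h : ∀ θ s, 2 * Real.cos s * g θ ≤ g (θ + s) + g (θ - s)) (θ : ℝ) : 0 ≤ g'' θ + g θ := by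
  set f : ℝ → ℝ := fun s => g (θ + s) + g (θ - s) - 2 * Real.cos s * g θ
  have hf : ∀ s, HasDerivAt f (g' (θ + s) - g' (θ - s) + 2 * Real.sin s * g θ) s := by
    intro s
    have e1 := (h1 (θ + s)).comp_const_add θ s
    have e2 := (h1 (θ - s)).comp_const_sub θ s
    refine ((e1.add e2).sub (((Real.hasDerivAt_cos s).const_mul 2).mul_const (g θ))).congr_deriv ?_
    ring
  have hf' : deriv f = fun s => g' (θ + s) - g' (θ - s) + 2 * Real.sin s * g θ :=
    funext fun s => (hf s).deriv
  have hff : HasDerivAt (deriv f) (2 * (g'' θ + g θ)) 0 := by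
    rw [hf']
    have e1 := (h2 (θ + 0)).comp_const_add θ 0
    have e2 := (h2 (θ - 0)).comp_const_sub θ 0
    refine ((e1.sub e2).add (((Real.hasDerivAt_sin 0).const_mul 2).mul_const (g θ))).congr_deriv ?_
    simp
    ring
  by_contra! hneg
  have hmax : IsLocalMax f 0 := isLocalMax_of_deriv_deriv_neg (by rw [hff.deriv]; linarith)
    (by simp [hf']) (hf 0).continuousAt
  have hzero : f =ᶠ[𝓝 0] fun _ => 0 := by
    filter_upwards [hmax] with s hs
    have h0 : f 0 = 0 := by simp [f]; ring
    have := h θ s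
    simp only [f] at hs h0 ⊢
    linarith
  have := hzero.deriv.deriv_eq
  rw [hff.deriv] at this
  simp at this
  linarith

/-! ### Periodic mollification -/

theorem Function.Periodic.deriv_periodic {f : ℝ → ℝ} {c : ℝ} (hf : Function.Periodic f c) :
    Function.Periodic (deriv f) c := fun x => by
  rw [← deriv_comp_add_const, show (fun y => f (y + c)) = f from funext hf]

theorem Function.Periodic.exists_abs_le {f : ℝ → ℝ} (hf : Function.Periodic f (2 * π))
    (hc : Continuous f) : ∃ M, ∀ x, |f x| ≤ M := by
  obtain ⟨M, hM⟩ := (hf.isBounded_of_continuous Real.two_pi_pos.ne' hc).exists_norm_le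
  exact ⟨M, fun x => hM _ ⟨x, rfl⟩⟩

/-- A smooth `2π`-periodic bump around `0`: it vanishes where `cos x ≤ κ` and equals `1` where
`cos x ≥ (1 + κ) / 2`. -/
def periodicBump (κ x : ℝ) : ℝ := Real.smoothTransition (2 * (Real.cos x - κ) / (1 - κ))

theorem contDiff_periodicBump (κ : ℝ) : ContDiff ℝ ∞ (periodicBump κ) :=
  Real.smoothTransition.contDiff.comp
    (((contDiff_const.mul (Real.contDiff_cos.sub contDiff_const))).div_const _)

theorem periodicBump_periodic (κ : ℝ) : Function.Periodic (periodicBump κ) (2 * π) := fun x => by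
  simp [periodicBump]

theorem periodicBump_nonneg (κ x : ℝ) : 0 ≤ periodicBump κ x := Real.smoothTransition.nonneg _

theorem periodicBump_eq_zero {κ x : ℝ} (hκ : κ < 1) (h : Real.cos x ≤ κ) : periodicBump κ x = 0 :=
  Real.smoothTransition.zero_of_nonpos
    (div_nonpos_of_nonpos_of_nonneg (by linarith) (by linarith))

theorem periodicBump_eq_one {κ x : ℝ} (hκ : κ < 1) (h : (1 + κ) / 2 ≤ Real.cos x) :
    periodicBump κ x = 1 :=
  Real.smoothTransition.one_of_one_le (by rw [le_div_iff₀ (by linarith)]; linarith)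

theorem integral_periodicBump_pos {κ : ℝ} (hκ : κ < 1) :
    0 < ∫ θ in (0 : ℝ)..(2 * π), periodicBump κ θ := by
  refine intervalIntegral.integral_pos Real.two_pi_pos
    (contDiff_periodicBump κ).continuous.continuousOn (fun x _ => periodicBump_nonneg κ x)
    ⟨0, left_mem_Icc.2 Real.two_pi_pos.le, ?_⟩
  rw [periodicBump_eq_one hκ (by rw [Real.cos_zero]; linarith)]
  exact one_pos

/-- The convolution of two `2π`-periodic functions. -/
def periodicConv (F h : ℝ → ℝ) (θ : ℝ) : ℝ := ∫ s in (0 : ℝ)..(2 * π), F (θ - s) * h s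

theorem hasDerivAt_periodicConv {F F' h : ℝ → ℝ} (hF : ∀ x, HasDerivAt F (F' x) x)
    (hF' : Continuous F') (hp : Function.Periodic F' (2 * π)) (hh : Continuous h) (θ : ℝ) :
    HasDerivAt (periodicConv F h) (periodicConv F' h θ) θ := by
  obtain ⟨M, hM⟩ := hp.exists_abs_le hF'
  have hFc : Continuous F := continuous_iff_continuousAt.2 fun x => (hF x).continuousAt
  refine (intervalIntegral.hasDerivAt_integral_of_dominated_loc_of_deriv_le (μ := volume)
    (F := fun θ s => F (θ - s) * h s) (F' := fun θ s => F' (θ - s) * h s) (s := univ)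
    (bound := fun s => M * |h s|) Filter.univ_mem ?_ ?_ ?_ ?_ ?_ ?_).2
  · exact Filter.Eventually.of_forall fun x =>
      (show Continuous fun s => F (x - s) * h s by fun_prop).aestronglyMeasurable
  · exact (show Continuous fun s => F (θ - s) * h s by fun_prop).intervalIntegrable _ _
  · exact (show Continuous fun s => F' (θ - s) * h s by fun_prop).aestronglyMeasurable
  · refine Filter.Eventually.of_forall fun s _ x _ => ?_
    rw [Real.norm_eq_abs, abs_mul]
    exact mul_le_mul_of_nonneg_right (hM _) (abs_nonneg _)
  · exact (show Continuous fun s => M * |h s| by fun_prop).intervalIntegrable _ _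
  · exact Filter.Eventually.of_forall fun s _ x _ => ((hF (x - s)).comp_sub_const x s).mul_const _

theorem periodicConv_eq_integral {F h : ℝ → ℝ} (hF : Function.Periodic F (2 * π))
    (hh : Function.Periodic h (2 * π)) (θ : ℝ) :
    periodicConv F h θ = ∫ u in (-π)..π, F u * h (θ - u) := by
  have hper : Function.Periodic (fun u => F u * h (θ - u)) (2 * π) := fun u => by
    simp only
    rw [hF, ← hh (θ - (u + 2 * π))]
    congr 2
    ring
  have h1 := intervalIntegral.integral_comp_sub_left (a := 0) (b := 2 * π)
    (fun u => F u * h (θ - u)) θ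
  simp only [sub_sub_cancel, sub_zero] at h1
  rw [periodicConv, h1]
  have h2 := hper.intervalIntegral_add_eq (θ - 2 * π) (-π)
  rwa [show θ - 2 * π + 2 * π = θ by ring, show -π + 2 * π = π by ring] at h2

/-- The average of `h` against the bump of parameter `κ`; a smooth approximation of `h`
as `κ → 1`. -/
def mollify (κ : ℝ) (h : ℝ → ℝ) (θ : ℝ) : ℝ :=
  (∫ s in (0 : ℝ)..(2 * π), periodicBump κ s)⁻¹ * periodicConv (periodicBump κ) h θ

theorem integral_periodicBump_eq (κ : ℝ) :
    ∫ s in (0 : ℝ)..(2 * π), periodicBump κ s = ∫ s in (-π)..π, periodicBump κ s := by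
  have h2 := (periodicBump_periodic κ).intervalIntegral_add_eq 0 (-π)
  rwa [zero_add, show -π + 2 * π = π by ring] at h2

/-- The bump of parameter `κ` vanishes on `[-π, π]` where `|u| > arccos κ`, so that `mollify κ h θ`
is an average of values of `h` at distance at most `arccos κ` from `θ`. -/
theorem abs_mollify_sub_le {κ : ℝ} (hκ : κ < 1) {h : ℝ → ℝ} (hc : Continuous h)
    (hp : Function.Periodic h (2 * π)) {θ r m : ℝ}
    (hr : ∀ u, |u| ≤ Real.arccos κ → |h (θ - u) - m| ≤ r) : |mollify κ h θ - m| ≤ r := by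
  have hI := integral_periodicBump_pos hκ
  have hbc := (contDiff_periodicBump κ).continuous
  have hle : -π ≤ π := by linarith [Real.pi_pos]
  rw [← mul_le_mul_iff_right₀ hI, ← abs_of_pos hI, ← abs_mul, abs_of_pos hI, mul_sub, mollify,
    mul_inv_cancel_left₀ hI.ne', periodicConv_eq_integral (periodicBump_periodic κ) hp,
    integral_periodicBump_eq, ← intervalIntegral.integral_mul_const,
    ← intervalIntegral.integral_mul_const,
    ← intervalIntegral.integral_sub ((by fun_prop : Continuous _).intervalIntegrable _ _)
      ((by fun_prop : Continuous _).intervalIntegrable _ _), ← Real.norm_eq_abs]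
  refine intervalIntegral.norm_integral_le_of_norm_le hle
    (Filter.Eventually.of_forall fun u hu => ?_)
    ((by fun_prop : Continuous _).intervalIntegrable _ _)
  rw [← mul_sub, Real.norm_eq_abs, abs_mul, abs_of_nonneg (periodicBump_nonneg κ u)]
  rcases le_or_gt (Real.cos u) κ with h1 | h1
  · simp [periodicBump_eq_zero hκ h1]
  · refine mul_le_mul_of_nonneg_left (hr u ?_) (periodicBump_nonneg κ u)
    have hu' : |u| ≤ π := abs_le.2 ⟨hu.1.le, hu.2⟩
    rw [← Real.arccos_cos (abs_nonneg u) hu', Real.cos_abs]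
    exact Real.antitone_arccos h1.le

theorem tendsto_mollify {h : ℝ → ℝ} (hc : Continuous h) (hp : Function.Periodic h (2 * π))
    (θ : ℝ) : Filter.Tendsto (fun κ => mollify κ h θ) (𝓝[<] 1) (𝓝 (h θ)) := by
  rw [Metric.tendsto_nhds]
  intro ε hε
  obtain ⟨δ, hδ, hδε⟩ := Metric.continuousAt_iff.1
    ((show Continuous fun u => h (θ - u) by fun_prop).continuousAt (x := 0)) (ε / 2) (by positivity)
  have harc : ∀ᶠ κ in 𝓝[<] (1 : ℝ), Real.arccos κ < δ := by
    refine nhdsWithin_le_nhds (Real.continuous_arccos.continuousAt.eventually_lt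
      continuousAt_const (by simpa using hδ))
  filter_upwards [harc, self_mem_nhdsWithin] with κ h1 h2
  rw [Real.dist_eq]
  refine (abs_mollify_sub_le h2 hc hp (r := ε / 2) fun u hu => ?_).trans_lt (by linarith)
  have := hδε (show dist u 0 < δ by simpa using hu.trans_lt h1)
  simpa [Real.dist_eq] using this.le

theorem abs_mollify_le {κ : ℝ} (hκ : κ < 1) {h : ℝ → ℝ} (hc : Continuous h)
    (hp : Function.Periodic h (2 * π)) {M : ℝ} (hM : ∀ θ, |h θ| ≤ M) (θ : ℝ) :
    |mollify κ h θ| ≤ M := by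
  simpa using abs_mollify_sub_le hκ hc hp (θ := θ) (r := M) (m := 0) fun u _ => by
    simpa using hM (θ - u)

theorem ContDiff.hasDerivAt_deriv {f : ℝ → ℝ} (hf : ContDiff ℝ ∞ f) (x : ℝ) :
    HasDerivAt f (deriv f x) x :=
  (hf.differentiable (by simp) x).hasDerivAt

theorem ContDiff.contDiff_deriv {f : ℝ → ℝ} (hf : ContDiff ℝ ∞ f) : ContDiff ℝ ∞ (deriv f) :=
  (contDiff_infty_iff_deriv.1 hf).2

theorem iteratedDeriv_two_eq (f : ℝ → ℝ) : iteratedDeriv 2 f = deriv (deriv f) := by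
  rw [iteratedDeriv_succ, iteratedDeriv_one]

theorem ContDiff.hasDerivAt_iteratedDeriv_two {f : ℝ → ℝ} (hf : ContDiff ℝ ∞ f) (x : ℝ) :
    HasDerivAt (deriv f) (iteratedDeriv 2 f x) x := by
  rw [iteratedDeriv_two_eq]
  exact hf.contDiff_deriv.hasDerivAt_deriv x

theorem ContDiff.continuous_iteratedDeriv_two {f : ℝ → ℝ} (hf : ContDiff ℝ ∞ f) :
    Continuous (iteratedDeriv 2 f) := by
  rw [iteratedDeriv_two_eq]
  exact hf.contDiff_deriv.contDiff_deriv.continuous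

theorem hasDerivAt_mollify (κ : ℝ) {h : ℝ → ℝ} (hc : Continuous h) (θ : ℝ) :
    HasDerivAt (mollify κ h) ((∫ s in (0 : ℝ)..(2 * π), periodicBump κ s)⁻¹ *
      periodicConv (deriv (periodicBump κ)) h θ) θ :=
  (hasDerivAt_periodicConv (contDiff_periodicBump κ).hasDerivAt_deriv
    (contDiff_periodicBump κ).contDiff_deriv.continuous
    (periodicBump_periodic κ).deriv_periodic hc θ).const_mul _

theorem hasDerivAt_deriv_mollify (κ : ℝ) {h : ℝ → ℝ} (hc : Continuous h) (θ : ℝ) :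
    HasDerivAt (fun θ => (∫ s in (0 : ℝ)..(2 * π), periodicBump κ s)⁻¹ *
      periodicConv (deriv (periodicBump κ)) h θ) ((∫ s in (0 : ℝ)..(2 * π), periodicBump κ s)⁻¹ *
      periodicConv (iteratedDeriv 2 (periodicBump κ)) h θ) θ := by
  refine (hasDerivAt_periodicConv (contDiff_periodicBump κ).hasDerivAt_iteratedDeriv_two
    (contDiff_periodicBump κ).continuous_iteratedDeriv_two ?_ hc θ).const_mul _
  rw [iteratedDeriv_two_eq]
  exact (periodicBump_periodic κ).deriv_periodic.deriv_periodic

/-- Averages of translates inherit the inequality of `two_cos_mul_supportFn_le`. -/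
theorem two_cos_mul_mollify_le {κ : ℝ} (hκ : κ < 1) {h : ℝ → ℝ} (hc : Continuous h)
    (hp : Function.Periodic h (2 * π))
    (hh : ∀ θ s, 2 * Real.cos s * h θ ≤ h (θ + s) + h (θ - s)) (θ s : ℝ) :
    2 * Real.cos s * mollify κ h θ ≤ mollify κ h (θ + s) + mollify κ h (θ - s) := by
  have hbc := (contDiff_periodicBump κ).continuous
  simp only [mollify, periodicConv_eq_integral (periodicBump_periodic κ) hp]
  rw [← mul_add, mul_left_comm, ← intervalIntegral.integral_add
    ((by fun_prop : Continuous _).intervalIntegrable _ _)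
    ((by fun_prop : Continuous _).intervalIntegrable _ _), ← intervalIntegral.integral_const_mul]
  refine mul_le_mul_of_nonneg_left (intervalIntegral.integral_mono_on (by linarith [Real.pi_pos])
    ((by fun_prop : Continuous _).intervalIntegrable _ _)
    ((by fun_prop : Continuous _).intervalIntegrable _ _) fun u _ => ?_)
    (inv_nonneg.2 (integral_periodicBump_pos hκ).le)
  have := mul_le_mul_of_nonneg_left (hh (θ - u) s) (periodicBump_nonneg κ u)
  rw [show θ + s - u = θ - u + s by ring, show θ - s - u = θ - u - s by ring]
  linarith

/-! ### Multiplying the curvature measure by a smooth function -/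

/-- The distribution `h'' + h` on the circle, evaluated at the test function `f`. -/
def curvaturePairing (h f : ℝ → ℝ) : ℝ :=
  ∫ θ in (0 : ℝ)..(2 * π), h θ * (iteratedDeriv 2 f θ + f θ)

theorem iteratedDeriv_two_mul {f g : ℝ → ℝ} (hf : ContDiff ℝ ∞ f) (hg : ContDiff ℝ ∞ g) (x : ℝ) :
    iteratedDeriv 2 (fun x => f x * g x) x =
      iteratedDeriv 2 f x * g x + 2 * deriv f x * deriv g x + f x * iteratedDeriv 2 g x := by
  have h1 : deriv (fun x => f x * g x) = fun x => deriv f x * g x + f x * deriv g x :=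
    funext fun x => ((hf.hasDerivAt_deriv x).mul (hg.hasDerivAt_deriv x)).deriv
  rw [iteratedDeriv_two_eq, h1]
  refine ((((hf.hasDerivAt_iteratedDeriv_two x).mul (hg.hasDerivAt_deriv x)).add
    ((hf.hasDerivAt_deriv x).mul (hg.hasDerivAt_iteratedDeriv_two x))).congr_deriv ?_).deriv
  ring

theorem iteratedDeriv_two_cos (x : ℝ) : iteratedDeriv 2 Real.cos x = -Real.cos x := by
  rw [iteratedDeriv_two_eq, Real.deriv_cos']
  simp

theorem iteratedDeriv_two_sin (x : ℝ) : iteratedDeriv 2 Real.sin x = -Real.sin x := by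
  rw [iteratedDeriv_two_eq, Real.deriv_sin]
  simp

/-- The function `(φ cos)'' + φ cos`. -/
def cosWeight (φ : ℝ → ℝ) (θ : ℝ) : ℝ :=
  Real.cos θ * iteratedDeriv 2 φ θ - 2 * Real.sin θ * deriv φ θ

/-- The function `(φ sin)'' + φ sin`. -/
def sinWeight (φ : ℝ → ℝ) (θ : ℝ) : ℝ :=
  Real.sin θ * iteratedDeriv 2 φ θ + 2 * Real.cos θ * deriv φ θ

/-- A solution `v` of `v'' + v = φ (h'' + h)`. It is the variation of constants formula
`∫₀^θ sin(θ-s) φ(s) (h'' + h)(s) ds`, integrated by parts until no derivative of `h` is left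
(and normalised by dropping boundary terms at `0`). -/
def curvatureMul (φ h : ℝ → ℝ) (θ : ℝ) : ℝ :=
  φ θ * h θ + Real.sin θ * (∫ s in (0 : ℝ)..θ, h s * cosWeight φ s)
    - Real.cos θ * ∫ s in (0 : ℝ)..θ, h s * sinWeight φ s

section

variable {φ h : ℝ → ℝ}

theorem continuous_cosWeight (hφ : ContDiff ℝ ∞ φ) : Continuous (cosWeight φ) := by
  have := hφ.continuous_iteratedDeriv_two
  have := hφ.contDiff_deriv.continuous
  unfold cosWeight
  fun_prop

theorem continuous_sinWeight (hφ : ContDiff ℝ ∞ φ) : Continuous (sinWeight φ) := by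
  have := hφ.continuous_iteratedDeriv_two
  have := hφ.contDiff_deriv.continuous
  unfold sinWeight
  fun_prop

theorem continuous_mul_cosWeight (hφ : ContDiff ℝ ∞ φ) (hh : Continuous h) :
    Continuous fun s => h s * cosWeight φ s :=
  hh.mul (continuous_cosWeight hφ)

theorem continuous_mul_sinWeight (hφ : ContDiff ℝ ∞ φ) (hh : Continuous h) :
    Continuous fun s => h s * sinWeight φ s :=
  hh.mul (continuous_sinWeight hφ)

theorem curvaturePairing_mul_cos (hφ : ContDiff ℝ ∞ φ) :
    curvaturePairing h (fun θ => φ θ * Real.cos θ)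
      = ∫ θ in (0 : ℝ)..(2 * π), h θ * cosWeight φ θ := by
  refine intervalIntegral.integral_congr fun θ _ => ?_
  simp only [iteratedDeriv_two_mul hφ Real.contDiff_cos, iteratedDeriv_two_cos, Real.deriv_cos,
    cosWeight]
  ring

theorem curvaturePairing_mul_sin (hφ : ContDiff ℝ ∞ φ) :
    curvaturePairing h (fun θ => φ θ * Real.sin θ)
      = ∫ θ in (0 : ℝ)..(2 * π), h θ * sinWeight φ θ := by
  refine intervalIntegral.integral_congr fun θ _ => ?_
  simp only [iteratedDeriv_two_mul hφ Real.contDiff_sin, iteratedDeriv_two_sin, Real.deriv_sin,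
    sinWeight]
  ring

theorem hasDerivAt_primitive {f : ℝ → ℝ} (hf : Continuous f) (θ : ℝ) :
    HasDerivAt (fun θ => ∫ s in (0 : ℝ)..θ, f s) (f θ) θ :=
  intervalIntegral.integral_hasDerivAt_right (hf.intervalIntegrable _ _)
    (hf.stronglyMeasurableAtFilter _ _) hf.continuousAt

theorem continuous_primitive {f : ℝ → ℝ} (hf : Continuous f) :
    Continuous fun θ => ∫ s in (0 : ℝ)..θ, f s :=
  continuous_iff_continuousAt.2 fun θ => (hasDerivAt_primitive hf θ).continuousAt

theorem continuous_curvatureMul (hφ : ContDiff ℝ ∞ φ) (hh : Continuous h) :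
    Continuous (curvatureMul φ h) := by
  have := hφ.continuous
  have := continuous_primitive (continuous_mul_cosWeight hφ hh)
  have := continuous_primitive (continuous_mul_sinWeight hφ hh)
  unfold curvatureMul
  fun_prop

theorem curvatureMul_one_add (hφ : ContDiff ℝ ∞ φ) (h : ℝ → ℝ) (t θ : ℝ) :
    curvatureMul (fun θ => 1 + t * φ θ) h θ = h θ + t * curvatureMul φ h θ := by
  have h1 : deriv (fun θ => 1 + t * φ θ) = fun θ => t * deriv φ θ :=
    funext fun x => (((hφ.hasDerivAt_deriv x).const_mul t).const_add 1).deriv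
  have h2 : iteratedDeriv 2 (fun θ => 1 + t * φ θ) = fun θ => t * iteratedDeriv 2 φ θ := by
    rw [iteratedDeriv_two_eq, h1]
    exact funext fun x => ((hφ.hasDerivAt_iteratedDeriv_two x).const_mul t).deriv
  have hc : ∀ s, h s * cosWeight (fun θ => 1 + t * φ θ) s = t * (h s * cosWeight φ s) := by
    intro s
    simp only [cosWeight, h1, h2]
    ring
  have hs : ∀ s, h s * sinWeight (fun θ => 1 + t * φ θ) s = t * (h s * sinWeight φ s) := by
    intro s
    simp only [sinWeight, h1, h2]
    ring
  simp only [curvatureMul, hc, hs, intervalIntegral.integral_const_mul]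
  ring

theorem trigConvex_curvatureMul_of_hasDerivAt {h' h'' : ℝ → ℝ} (hφ : ContDiff ℝ ∞ φ)
    (hφ0 : ∀ θ, 0 ≤ φ θ) (h1 : ∀ x, HasDerivAt h (h' x) x) (h2 : ∀ x, HasDerivAt h' (h'' x) x)
    (hh : ∀ x, 0 ≤ h'' x + h x) : TrigConvex (curvatureMul φ h) := by
  have hc : Continuous h := continuous_iff_continuousAt.2 fun x => (h1 x).continuousAt
  have dP := hasDerivAt_primitive (continuous_mul_cosWeight hφ hc)
  have dQ := hasDerivAt_primitive (continuous_mul_sinWeight hφ hc)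
  refine trigConvex_of_hasDerivAt
    (g' := fun θ => φ θ * h' θ - deriv φ θ * h θ
      + Real.cos θ * (∫ s in (0 : ℝ)..θ, h s * cosWeight φ s)
      + Real.sin θ * ∫ s in (0 : ℝ)..θ, h s * sinWeight φ s)
    (g'' := fun θ => φ θ * h'' θ - Real.sin θ * (∫ s in (0 : ℝ)..θ, h s * cosWeight φ s)
      + Real.cos θ * ∫ s in (0 : ℝ)..θ, h s * sinWeight φ s) (fun θ => ?_) (fun θ => ?_)
    (fun θ => ?_)
  · refine ((((hφ.hasDerivAt_deriv θ).mul (h1 θ)).add ((Real.hasDerivAt_sin θ).mul (dP θ))).sub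
      ((Real.hasDerivAt_cos θ).mul (dQ θ))).congr_deriv ?_
    simp only [cosWeight, sinWeight]
    linear_combination (-2 * deriv φ θ * h θ) * Real.sin_sq_add_cos_sq θ
  · refine (((((hφ.hasDerivAt_deriv θ).mul (h2 θ)).sub
      ((hφ.hasDerivAt_iteratedDeriv_two θ).mul (h1 θ))).add
      ((Real.hasDerivAt_cos θ).mul (dP θ))).add
      ((Real.hasDerivAt_sin θ).mul (dQ θ))).congr_deriv ?_
    simp only [cosWeight, sinWeight]
    linear_combination (iteratedDeriv 2 φ θ * h θ) * Real.sin_sq_add_cos_sq θ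
  · have := mul_nonneg (hφ0 θ) (hh θ)
    simp only [curvatureMul]
    linarith

theorem tendsto_integral_mollify_mul {w : ℝ → ℝ} (hw : Continuous w) (hc : Continuous h)
    (hp : Function.Periodic h (2 * π)) (θ : ℝ) :
    Filter.Tendsto (fun κ => ∫ s in (0 : ℝ)..θ, mollify κ h s * w s) (𝓝[<] 1)
      (𝓝 (∫ s in (0 : ℝ)..θ, h s * w s)) := by
  obtain ⟨M, hM⟩ := hp.exists_abs_le hc
  refine intervalIntegral.tendsto_integral_filter_of_dominated_convergence
    (fun s => M * |w s|) ?_ ?_ ((by fun_prop : Continuous _).intervalIntegrable _ _) ?_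
  · refine Filter.Eventually.of_forall fun κ => Continuous.aestronglyMeasurable ?_
    have : Continuous (mollify κ h) :=
      continuous_iff_continuousAt.2 fun x => (hasDerivAt_mollify κ hc x).continuousAt
    fun_prop
  · filter_upwards [self_mem_nhdsWithin] with κ hκ
    refine Filter.Eventually.of_forall fun s _ => ?_
    rw [Real.norm_eq_abs, abs_mul]
    exact mul_le_mul_of_nonneg_right (abs_mollify_le hκ hc hp hM s) (abs_nonneg _)
  · exact Filter.Eventually.of_forall fun s _ => (tendsto_mollify hc hp s).mul_const _

/-- The smooth case passes to the limit, since `curvatureMul φ h` contains no derivative of `h`. -/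
theorem trigConvex_curvatureMul (K : NonemptyCompacts Plane) (hφ : ContDiff ℝ ∞ φ)
    (hφ0 : ∀ θ, 0 ≤ φ θ) : TrigConvex (curvatureMul φ (supportFn K)) := by
  have hc := continuous_supportFn K
  have hp := supportFn_periodic K
  refine TrigConvex.of_tendsto (l := 𝓝[<] 1)
    (G := fun κ => curvatureMul φ (mollify κ (supportFn K))) ?_ fun θ => ?_
  · filter_upwards [self_mem_nhdsWithin] with κ hκ
    exact trigConvex_curvatureMul_of_hasDerivAt hφ hφ0 (hasDerivAt_mollify κ hc)
      (hasDerivAt_deriv_mollify κ hc) (second_deriv_add_self_nonneg (hasDerivAt_mollify κ hc)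
      (hasDerivAt_deriv_mollify κ hc)
      (two_cos_mul_mollify_le hκ hc hp (two_cos_mul_supportFn_le K)))
  · exact (((tendsto_mollify hc hp θ).const_mul _).add
      ((tendsto_integral_mollify_mul (continuous_cosWeight hφ) hc hp θ).const_mul _)).sub
      ((tendsto_integral_mollify_mul (continuous_sinWeight hφ) hc hp θ).const_mul _)

theorem integral_zero_add_two_pi {f : ℝ → ℝ} (hf : Continuous f)
    (hp : Function.Periodic f (2 * π)) (h0 : ∫ s in (0 : ℝ)..(2 * π), f s = 0) (θ : ℝ) :
    ∫ s in (0 : ℝ)..(θ + 2 * π), f s = ∫ s in (0 : ℝ)..θ, f s := by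
  have := hp.intervalIntegral_add_eq_add 0 θ fun _ _ => hf.intervalIntegrable _ _
  rw [this, zero_add, h0, add_zero]

/-- The moment conditions say that `φ (h'' + h)` is orthogonal to the solutions of `v'' + v = 0`,
which is the solvability condition on the circle. -/
theorem curvatureMul_periodic (hφ : ContDiff ℝ ∞ φ) (hφp : Function.Periodic φ (2 * π))
    (hh : Continuous h) (hp : Function.Periodic h (2 * π))
    (hcos : curvaturePairing h (fun θ => φ θ * Real.cos θ) = 0)
    (hsin : curvaturePairing h (fun θ => φ θ * Real.sin θ) = 0) :
    Function.Periodic (curvatureMul φ h) (2 * π) := by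
  rw [curvaturePairing_mul_cos hφ] at hcos
  rw [curvaturePairing_mul_sin hφ] at hsin
  have h1 : Function.Periodic (deriv φ) (2 * π) := hφp.deriv_periodic
  have h2 : Function.Periodic (iteratedDeriv 2 φ) (2 * π) := by
    rw [iteratedDeriv_two_eq]
    exact h1.deriv_periodic
  intro θ
  simp only [curvatureMul]
  rw [integral_zero_add_two_pi (continuous_mul_cosWeight hφ hh) (fun s => ?_) hcos,
    integral_zero_add_two_pi (continuous_mul_sinWeight hφ hh) (fun s => ?_) hsin, hφp, hp,
    Real.sin_add_two_pi, Real.cos_add_two_pi]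
  · simp only [sinWeight, hp s, h1 s, h2 s, Real.sin_add_two_pi, Real.cos_add_two_pi]
  · simp only [cosWeight, hp s, h1 s, h2 s, Real.sin_add_two_pi, Real.cos_add_two_pi]

/-- The equation `v'' + v = φ (h'' + h)` in the sense of distributions. -/
theorem curvaturePairing_curvatureMul (hφ : ContDiff ℝ ∞ φ) (hh : Continuous h)
    (hcos : curvaturePairing h (fun θ => φ θ * Real.cos θ) = 0)
    (hsin : curvaturePairing h (fun θ => φ θ * Real.sin θ) = 0) {ψ : ℝ → ℝ}
    (hψ : ContDiff ℝ ∞ ψ) :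
    curvaturePairing (curvatureMul φ h) ψ = curvaturePairing h (fun θ => φ θ * ψ θ) := by
  rw [curvaturePairing_mul_cos hφ] at hcos
  rw [curvaturePairing_mul_sin hφ] at hsin
  have hP := continuous_mul_cosWeight hφ hh
  have hQ := continuous_mul_sinWeight hφ hh
  have hψc := hψ.continuous
  have hψ1 := hψ.contDiff_deriv.continuous
  have hψ2 := hψ.continuous_iteratedDeriv_two
  have hφc := hφ.continuous
  have hφ1 := hφ.contDiff_deriv.continuous
  have hφ2 := hφ.continuous_iteratedDeriv_two
  -- The integrals from `0` vanish at both ends of the period, so no boundary term appears.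
  have key : ∀ θ, HasDerivAt (fun θ =>
      (∫ s in (0 : ℝ)..θ, h s * cosWeight φ s) * (Real.sin θ * deriv ψ θ - Real.cos θ * ψ θ)
      - (∫ s in (0 : ℝ)..θ, h s * sinWeight φ s) * (Real.cos θ * deriv ψ θ + Real.sin θ * ψ θ))
      (curvatureMul φ h θ * (iteratedDeriv 2 ψ θ + ψ θ)
        - h θ * (iteratedDeriv 2 (fun θ => φ θ * ψ θ) θ + φ θ * ψ θ)) θ := by
    intro θ
    refine (((hasDerivAt_primitive hP θ).mul
      (((Real.hasDerivAt_sin θ).mul (hψ.hasDerivAt_iteratedDeriv_two θ)).sub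
        ((Real.hasDerivAt_cos θ).mul (hψ.hasDerivAt_deriv θ)))).sub
      ((hasDerivAt_primitive hQ θ).mul
      (((Real.hasDerivAt_cos θ).mul (hψ.hasDerivAt_iteratedDeriv_two θ)).add
        ((Real.hasDerivAt_sin θ).mul (hψ.hasDerivAt_deriv θ))))).congr_deriv ?_
    rw [iteratedDeriv_two_mul hφ hψ]
    simp only [curvatureMul, cosWeight, sinWeight, Pi.sub_apply, Pi.mul_apply, Pi.add_apply]
    linear_combination (-h θ * (iteratedDeriv 2 φ θ * ψ θ + 2 * deriv φ θ * deriv ψ θ))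
      * Real.sin_sq_add_cos_sq θ
  have hc1 := continuous_curvatureMul hφ hh
  have hc2 : Continuous (iteratedDeriv 2 fun θ => φ θ * ψ θ) :=
    (hφ.mul hψ).continuous_iteratedDeriv_two
  have hi1 : Continuous fun θ => curvatureMul φ h θ * (iteratedDeriv 2 ψ θ + ψ θ) := by fun_prop
  have hi2 : Continuous fun θ => h θ * (iteratedDeriv 2 (fun θ => φ θ * ψ θ) θ + φ θ * ψ θ) := by
    fun_prop
  have := intervalIntegral.integral_eq_sub_of_hasDerivAt (a := 0) (b := 2 * π)
    (fun θ _ => key θ) ((hi1.sub hi2).intervalIntegrable _ _)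
  rw [intervalIntegral.integral_sub (hi1.intervalIntegrable _ _) (hi2.intervalIntegrable _ _),
    hcos, hsin] at this
  simp only [intervalIntegral.integral_same, zero_mul, sub_zero] at this
  exact sub_eq_zero.1 this

end

/-! ### Strict convexity of the functional -/

theorem memLp_top_supportFn (K : NonemptyCompacts Plane) :
    MemLp (supportFn K) ∞ (volume.restrict (Ioc 0 (2 * π))) := by
  obtain ⟨M, hM⟩ := (supportFn_periodic K).exists_abs_le (continuous_supportFn K)
  exact memLp_top_of_bound (continuous_supportFn K).aestronglyMeasurable M
    (Filter.Eventually.of_forall hM)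

theorem memLp_top_deriv_supportFn (K : NonemptyCompacts Plane) :
    MemLp (deriv (supportFn K)) ∞ (volume.restrict (Ioc 0 (2 * π))) := by
  obtain ⟨C, hC⟩ := exists_lipschitzWith_supportFn K
  exact memLp_top_of_bound (measurable_deriv _).aestronglyMeasurable C
    (Filter.Eventually.of_forall fun θ => norm_deriv_le_of_lipschitz hC)

theorem integrable_functionalJ {a b c d : ℝ → ℝ}
    (ha : MemLp a ∞ (volume.restrict (Ioc 0 (2 * π))))
    (hb : MemLp b ∞ (volume.restrict (Ioc 0 (2 * π))))
    (hc : MemLp c ∞ (volume.restrict (Ioc 0 (2 * π))))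
    (hd : MemLp d ∞ (volume.restrict (Ioc 0 (2 * π)))) (K : NonemptyCompacts Plane) :
    Integrable (fun θ => a θ * supportFn K θ ^ 2 + b θ * deriv (supportFn K) θ ^ 2
      + c θ * supportFn K θ + d θ * deriv (supportFn K) θ) (volume.restrict (Ioc 0 (2 * π))) := by
  have h0 := memLp_top_supportFn K
  have h1 := memLp_top_deriv_supportFn K
  have e1 : MemLp (fun θ => a θ * supportFn K θ ^ 2) ∞ (volume.restrict (Ioc 0 (2 * π))) := by
    simpa only [pow_two] using (h0.mul' (r := ∞) h0).mul' (r := ∞) ha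
  have e2 : MemLp (fun θ => b θ * deriv (supportFn K) θ ^ 2) ∞
      (volume.restrict (Ioc 0 (2 * π))) := by
    simpa only [pow_two] using (h1.mul' (r := ∞) h1).mul' (r := ∞) hb
  exact (((e1.add e2).add (h0.mul' (r := ∞) hc)).add (h1.mul' (r := ∞) hd)).integrable le_top

theorem ae_differentiableAt_supportFn (K : NonemptyCompacts Plane) :
    ∀ᵐ θ, DifferentiableAt ℝ (supportFn K) θ := by
  obtain ⟨C, hC⟩ := exists_lipschitzWith_supportFn K
  exact hC.ae_differentiableAt_real

theorem Function.Periodic.eq_of_eqOn_Icc {f g : ℝ → ℝ} (hf : Function.Periodic f (2 * π))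
    (hg : Function.Periodic g (2 * π)) (h : EqOn f g (Icc 0 (2 * π))) : f = g := by
  funext x
  have hx := toIcoMod_mem_Ico Real.two_pi_pos 0 x
  rw [zero_add] at hx
  have := h (Ico_subset_Icc_self hx)
  simpa only [toIcoMod, hf.sub_zsmul_eq, hg.sub_zsmul_eq] using this

/-- If the derivatives agree almost everywhere, the difference is constant, and the perimeter
condition makes the constant zero. -/
theorem supportFn_eq_of_deriv_ae_eq {K₁ K₂ : NonemptyCompacts Plane}
    (hP : perimeter K₁ = perimeter K₂)
    (h : ∀ᵐ θ ∂(volume.restrict (Ioc 0 (2 * π))),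
      deriv (supportFn K₁) θ = deriv (supportFn K₂) θ) : supportFn K₁ = supportFn K₂ := by
  obtain ⟨C₁, hC₁⟩ := exists_lipschitzWith_supportFn K₁
  obtain ⟨C₂, hC₂⟩ := exists_lipschitzWith_supportFn K₂
  set f := fun θ => supportFn K₁ θ - supportFn K₂ θ
  have hf : LipschitzWith (C₁ + C₂) f := hC₁.sub hC₂
  have hd : ∀ᵐ θ, θ ∈ Ioc 0 (2 * π) → deriv f θ = 0 := by
    rw [ae_restrict_iff' measurableSet_Ioc] at h
    filter_upwards [h, ae_differentiableAt_supportFn K₁, ae_differentiableAt_supportFn K₂]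
      with θ h1 h2 h3 h4
    rw [deriv_fun_sub h2 h3, h1 h4, sub_self]
  have hconst : ∀ θ ∈ Icc 0 (2 * π), f θ = f 0 := by
    intro θ hθ
    have h1 := (hf.lipschitzOnWith (s := uIcc 0 θ)).absolutelyContinuousOnInterval
    have h2 := h1.integral_deriv_eq_sub
    rw [intervalIntegral.integral_zero_ae] at h2
    · linarith
    · filter_upwards [hd] with s hs hs'
      rw [uIoc_of_le hθ.1] at hs'
      exact hs ⟨hs'.1, hs'.2.trans hθ.2⟩
  have hint : ∫ θ in (0 : ℝ)..(2 * π), f θ = 0 := by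
    rw [intervalIntegral.integral_sub ((continuous_supportFn K₁).intervalIntegrable _ _)
      ((continuous_supportFn K₂).intervalIntegrable _ _)]
    exact sub_eq_zero.2 hP
  have h0 : f 0 = 0 := by
    rw [intervalIntegral.integral_congr (g := fun _ => f 0) fun θ hθ => hconst θ
      (by rwa [uIcc_of_le Real.two_pi_pos.le] at hθ)] at hint
    simpa [Real.pi_ne_zero] using hint
  exact (supportFn_periodic K₁).eq_of_eqOn_Icc (supportFn_periodic K₂) fun θ hθ =>
    sub_eq_zero.1 ((hconst θ hθ).trans h0)

/-- The second difference of the functional is half the integral of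
`a (h₁ - h₂)² + b (h₁' - h₂')²`, which is positive; where only `b > 0`, this uses that the perimeters
agree. -/
theorem two_mul_functionalJ_lt {a b c d : ℝ → ℝ}
    (ha : MemLp a ∞ (volume.restrict (Ioc 0 (2 * π))))
    (hb : MemLp b ∞ (volume.restrict (Ioc 0 (2 * π))))
    (hc : MemLp c ∞ (volume.restrict (Ioc 0 (2 * π))))
    (hd : MemLp d ∞ (volume.restrict (Ioc 0 (2 * π))))
    (ha0 : ∀ᵐ θ ∂(volume.restrict (Ioc 0 (2 * π))), 0 ≤ a θ)
    (hb0 : ∀ᵐ θ ∂(volume.restrict (Ioc 0 (2 * π))), 0 ≤ b θ)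
    (hpos : (∀ᵐ θ ∂(volume.restrict (Ioc 0 (2 * π))), 0 < a θ) ∨
      (∀ᵐ θ ∂(volume.restrict (Ioc 0 (2 * π))), 0 < b θ))
    {K K₁ K₂ : NonemptyCompacts Plane}
    (hmid : ∀ θ, supportFn K θ = (supportFn K₁ θ + supportFn K₂ θ) / 2)
    (hP : perimeter K₁ = perimeter K₂) (hne : supportFn K₁ ≠ supportFn K₂) :
    2 * functionalJ a b c d K < functionalJ a b c d K₁ + functionalJ a b c d K₂ := by
  set μ := volume.restrict (Ioc 0 (2 * π))
  have i0 := integrable_functionalJ ha hb hc hd K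
  have i1 := integrable_functionalJ ha hb hc hd K₁
  have i2 := integrable_functionalJ ha hb hc hd K₂
  set Q : ℝ → ℝ := fun θ => (a θ * (supportFn K₁ θ - supportFn K₂ θ) ^ 2
    + b θ * (deriv (supportFn K₁) θ - deriv (supportFn K₂) θ) ^ 2) / 2
  have hQ : (fun θ => (a θ * supportFn K₁ θ ^ 2 + b θ * deriv (supportFn K₁) θ ^ 2
      + c θ * supportFn K₁ θ + d θ * deriv (supportFn K₁) θ)
      + (a θ * supportFn K₂ θ ^ 2 + b θ * deriv (supportFn K₂) θ ^ 2
      + c θ * supportFn K₂ θ + d θ * deriv (supportFn K₂) θ)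
      - 2 * (a θ * supportFn K θ ^ 2 + b θ * deriv (supportFn K) θ ^ 2
      + c θ * supportFn K θ + d θ * deriv (supportFn K) θ)) =ᵐ[μ] Q := by
    refine ae_restrict_of_ae ?_
    filter_upwards [ae_differentiableAt_supportFn K₁, ae_differentiableAt_supportFn K₂]
      with θ h1 h2
    have hder : deriv (supportFn K) θ
        = (deriv (supportFn K₁) θ + deriv (supportFn K₂) θ) / 2 := by
      rw [show supportFn K = _ from funext hmid]
      exact ((h1.hasDerivAt.add h2.hasDerivAt).div_const 2).deriv
    rw [hder, hmid]
    simp only [Q]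
    ring
  have hQi : Integrable Q μ := ((i1.add i2).sub (i0.const_mul 2)).congr hQ
  have hQ0 : 0 ≤ᵐ[μ] Q := by
    filter_upwards [ha0, hb0] with θ h1 h2
    simp only [Q, Pi.zero_apply]
    positivity
  have hJ : functionalJ a b c d K₁ + functionalJ a b c d K₂ - 2 * functionalJ a b c d K
      = ∫ θ, Q θ ∂μ := by
    simp only [functionalJ, intervalIntegral.integral_of_le Real.two_pi_pos.le]
    rw [← integral_add i1 i2, ← integral_const_mul, ← integral_sub (i1.fun_add i2) (i0.const_mul 2)]
    exact integral_congr_ae hQ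
  have hQpos : 0 < ∫ θ, Q θ ∂μ := by
    refine (integral_nonneg_of_ae hQ0).lt_of_ne fun h0 => hne ?_
    have hz := (integral_eq_zero_iff_of_nonneg_ae hQ0 hQi).1 h0.symm
    rcases hpos with hp | hp
    · have hae : supportFn K₁ =ᵐ[μ] supportFn K₂ := by
        filter_upwards [hz, hp, hb0] with θ h1 h2 h3
        simp only [Q, Pi.zero_apply] at h1
        have h4 : 0 ≤ b θ * (deriv (supportFn K₁) θ - deriv (supportFn K₂) θ) ^ 2 := by positivity
        have h5 : 0 ≤ a θ * (supportFn K₁ θ - supportFn K₂ θ) ^ 2 := by positivity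
        have h6 : a θ * (supportFn K₁ θ - supportFn K₂ θ) ^ 2 = 0 := by linarith
        simpa [h2.ne', sub_eq_zero] using h6
      refine (supportFn_periodic K₁).eq_of_eqOn_Icc (supportFn_periodic K₂)
        (Measure.eqOn_Icc_of_ae_eq volume Real.two_pi_pos.ne ?_
          (continuous_supportFn K₁).continuousOn (continuous_supportFn K₂).continuousOn)
      rwa [← Measure.restrict_congr_set Ioc_ae_eq_Icc]
    · refine supportFn_eq_of_deriv_ae_eq hP ?_
      filter_upwards [hz, hp, ha0] with θ h1 h2 h3
      simp only [Q, Pi.zero_apply] at h1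
      have h4 : 0 ≤ b θ * (deriv (supportFn K₁) θ - deriv (supportFn K₂) θ) ^ 2 := by positivity
      have h5 : 0 ≤ a θ * (supportFn K₁ θ - supportFn K₂ θ) ^ 2 := by positivity
      have h6 : b θ * (deriv (supportFn K₁) θ - deriv (supportFn K₂) θ) ^ 2 = 0 := by linarith
      simpa [h2.ne', sub_eq_zero] using h6
  linarith

/-! ### The curvature of a polygon is carried by its normal directions -/

theorem curvaturePairing_inner_unitVec (x : Plane) {φ : ℝ → ℝ} (hφ : ContDiff ℝ ∞ φ)
    (hp : Function.Periodic φ (2 * π)) :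
    curvaturePairing (fun θ => inner ℝ x (unitVec θ)) φ = 0 := by
  have h2 := hφ.continuous_iteratedDeriv_two
  have hc := hφ.continuous
  simp only [curvaturePairing, inner_unitVec]
  have key : ∀ θ, HasDerivAt (fun θ => (x 0 * Real.cos θ + x 1 * Real.sin θ) * deriv φ θ
      - (x 1 * Real.cos θ - x 0 * Real.sin θ) * φ θ)
      ((x 0 * Real.cos θ + x 1 * Real.sin θ) * (iteratedDeriv 2 φ θ + φ θ)) θ := by
    intro θ
    have e1 := ((Real.hasDerivAt_cos θ).const_mul (x 0)).add
      ((Real.hasDerivAt_sin θ).const_mul (x 1))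
    have e2 := ((Real.hasDerivAt_cos θ).const_mul (x 1)).sub
      ((Real.hasDerivAt_sin θ).const_mul (x 0))
    refine ((e1.mul (hφ.hasDerivAt_iteratedDeriv_two θ)).sub
      (e2.mul (hφ.hasDerivAt_deriv θ))).congr_deriv ?_
    simp only [Pi.add_apply, Pi.sub_apply]
    ring
  rw [intervalIntegral.integral_eq_sub_of_hasDerivAt (fun θ _ => key θ)
    ((by fun_prop : Continuous _).intervalIntegrable _ _)]
  have e1 := hp 0
  have e2 := hp.deriv_periodic 0
  rw [zero_add] at e1 e2
  rw [e1, e2]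
  simp

theorem coe_addCircle_eq_iff {a b : ℝ} :
    (a : AddCircle (2 * π)) = b ↔ ∃ k : ℤ, a = b + k • (2 * π) := by
  rw [QuotientAddGroup.eq_iff_sub_mem, AddSubgroup.mem_zmultiples_iff]
  exact exists_congr fun k => ⟨fun h => by rw [h]; ring, fun h => by rw [h]; ring⟩

theorem notMem_curvatureSupport_of_eventuallyEq {h : ℝ → ℝ} (hp : Function.Periodic h (2 * π))
    {x : Plane} {θ₀ : ℝ} (hx : h =ᶠ[𝓝 θ₀] fun θ => inner ℝ x (unitVec θ)) :
    (θ₀ : AddCircle (2 * π)) ∉ curvatureSupport h := by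
  set g : ℝ → ℝ := fun θ => inner ℝ x (unitVec θ)
  have hgp : Function.Periodic g (2 * π) := fun θ => by simp only [g, unitVec_add_two_pi]
  set V : Set ℝ := interior {θ | h θ = g θ}
  have hV : V ⊆ {θ | h θ = g θ} := interior_subset
  have hU : ((↑) : ℝ → AddCircle (2 * π)) '' V ∈ 𝓝 (θ₀ : AddCircle (2 * π)) :=
    (QuotientAddGroup.isOpenMap_coe _ isOpen_interior).mem_nhds
      ⟨θ₀, mem_interior_iff_mem_nhds.2 hx, rfl⟩
  intro hmem
  obtain ⟨φ, hφ, hφp, hsupp, hne⟩ := hmem _ hU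
  refine hne ?_
  refine Eq.trans (intervalIntegral.integral_congr fun θ _ => ?_)
    (curvaturePairing_inner_unitVec x hφ hφp)
  by_cases hθ : θ ∈ tsupport φ
  · obtain ⟨θ', hθ', he⟩ := hsupp hθ
    have h1 : h θ' = g θ' := hV hθ'
    obtain ⟨k, hk⟩ := coe_addCircle_eq_iff.1 he
    have h2 : θ = θ' - k • (2 * π) := by linarith
    have h3 : h θ = g θ := by
      rw [h2, hp.sub_zsmul_eq, hgp.sub_zsmul_eq, h1]
    simp only [h3, g]
  · have h0 : φ =ᶠ[𝓝 θ] fun _ => 0 := notMem_tsupport_iff_eventuallyEq.1 hθ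
    have h1 : iteratedDeriv 2 φ θ = 0 := by
      rw [h0.iteratedDeriv_eq 2]
      simp
    simp [h1, h0.eq_of_nhds]

theorem supportFn_convexHull_range_le_iff {ι : Type*} {p : ι → Plane} {K : NonemptyCompacts Plane}
    (hK : (K : Set Plane) = convexHull ℝ (range p)) {θ r : ℝ} :
    supportFn K θ ≤ r ↔ ∀ i, inner ℝ (p i) (unitVec θ) ≤ r := by
  rw [supportFn_le_iff, hK]
  refine ⟨fun h i => h _ (subset_convexHull ℝ _ ⟨i, rfl⟩), fun h x hx => ?_⟩
  have hconv : Convex ℝ {x : Plane | inner ℝ x (unitVec θ) ≤ r} :=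
    convex_halfSpace_le (f := fun x : Plane => (inner ℝ x (unitVec θ) : ℝ))
      ⟨fun x y => inner_add_left x y _, fun c x => real_inner_smul_left x _ c⟩ r
  exact convexHull_min (by rintro _ ⟨i, rfl⟩; exact h i) hconv hx

/-- A direction in which a polygon has a single extreme vertex is not in the support of the
curvature: the vertex stays extreme nearby. -/
theorem exists_tie_of_mem_curvatureSupport {ι : Type*} [Finite ι] [Nonempty ι] {p : ι → Plane}
    {K : NonemptyCompacts Plane} (hK : (K : Set Plane) = convexHull ℝ (range p)) {θ₀ : ℝ}
    (h : (θ₀ : AddCircle (2 * π)) ∈ curvatureSupport (supportFn K)) :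
    ∃ i j, p i ≠ p j ∧ inner ℝ (p i) (unitVec θ₀) = supportFn K θ₀ ∧
      inner ℝ (p j) (unitVec θ₀) = supportFn K θ₀ := by
  have hle : ∀ θ i, inner ℝ (p i) (unitVec θ) ≤ supportFn K θ := fun θ =>
    (supportFn_convexHull_range_le_iff hK).1 le_rfl
  obtain ⟨i, hi⟩ := Finite.exists_max fun i => (inner ℝ (p i) (unitVec θ₀) : ℝ)
  have hi' : inner ℝ (p i) (unitVec θ₀) = supportFn K θ₀ :=
    le_antisymm (hle θ₀ i) ((supportFn_convexHull_range_le_iff hK).2 hi)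
  by_contra! hno
  refine notMem_curvatureSupport_of_eventuallyEq (supportFn_periodic K) (x := p i) ?_ h
  have hev : ∀ j, ∀ᶠ θ in 𝓝 θ₀, (inner ℝ (p j) (unitVec θ) : ℝ) ≤ inner ℝ (p i) (unitVec θ) := by
    intro j
    by_cases hj : p i = p j
    · simp [hj]
    · have hlt : (inner ℝ (p j) (unitVec θ₀) : ℝ) < inner ℝ (p i) (unitVec θ₀) :=
        (hi j).lt_of_ne fun he => hno i j hj hi' (he.trans hi')
      have hc : ∀ x : Plane, Continuous fun θ => (inner ℝ x (unitVec θ) : ℝ) := fun x =>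
        continuous_const.inner continuous_unitVec
      exact ((hc _).continuousAt.eventually_lt (hc _).continuousAt hlt).mono fun _ => le_of_lt
  filter_upwards [Filter.eventually_all.2 hev] with θ hθ
  exact le_antisymm ((supportFn_convexHull_range_le_iff hK).2 hθ) (hle θ i)

theorem unitVec_add_pi (θ : ℝ) : unitVec (θ + π) = -unitVec θ := by
  ext i
  fin_cases i <;> simp [unitVec]

/-- The directions orthogonal to a nonzero vector form an antipodal pair on the circle. -/
theorem coe_eq_or_eq_of_inner_unitVec_eq_zero {w : Plane} (hw : w ≠ 0) {θ θ' : ℝ}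
    (h : inner ℝ w (unitVec θ) = 0) (h' : inner ℝ w (unitVec θ') = 0) :
    (θ' : AddCircle (2 * π)) = θ ∨ (θ' : AddCircle (2 * π)) = (θ + π : ℝ) := by
  have hs : Real.sin (θ' - θ) = 0 := by
    rw [inner_unitVec] at h h'
    rw [Real.sin_sub]
    by_contra hne
    refine hw ?_
    ext i
    fin_cases i
    · refine (mul_eq_zero.1 (?_ : w 0 * (Real.sin θ' * Real.cos θ - Real.cos θ' * Real.sin θ)
        = 0)).resolve_right hne
      linear_combination Real.sin θ' * h - Real.sin θ * h'
    · refine (mul_eq_zero.1 (?_ : w 1 * (Real.sin θ' * Real.cos θ - Real.cos θ' * Real.sin θ)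
        = 0)).resolve_right hne
      linear_combination Real.cos θ * h' - Real.cos θ' * h
  obtain ⟨n, hn⟩ := Real.sin_eq_zero_iff.1 hs
  rcases Int.even_or_odd' n with ⟨m, hm | hm⟩
  · left
    refine coe_addCircle_eq_iff.2 ⟨m, ?_⟩
    rw [hm] at hn
    push_cast at hn
    rw [zsmul_eq_mul]
    linarith
  · right
    refine coe_addCircle_eq_iff.2 ⟨m, ?_⟩
    rw [hm] at hn
    push_cast at hn
    rw [zsmul_eq_mul]
    linarith

theorem encard_curvatureSupport_of_isLineSegment {K : NonemptyCompacts Plane}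
    (hK : IsLineSegment (K : Set Plane)) : (curvatureSupport (supportFn K)).encard ≤ 3 := by
  obtain ⟨p, q, hpq, hK⟩ := hK
  have hK' : (K : Set Plane) = convexHull ℝ (range ![p, q]) := by
    rw [hK, ← convexHull_pair]
    rw [Matrix.range_cons, Matrix.range_cons, Matrix.range_empty, union_empty, singleton_union]
  have horth : ∀ θ : ℝ, (θ : AddCircle (2 * π)) ∈ curvatureSupport (supportFn K) →
      inner ℝ (p - q) (unitVec θ) = 0 := by
    intro θ hθ
    obtain ⟨i, j, hij, hi, hj⟩ := exists_tie_of_mem_curvatureSupport hK' hθ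
    fin_cases i <;> fin_cases j <;> simp [inner_sub_left] at hij hi hj ⊢ <;> linarith
  rcases (curvatureSupport (supportFn K)).eq_empty_or_nonempty with h0 | ⟨x, hx⟩
  · simp [h0]
  · obtain ⟨θ, rfl⟩ := QuotientAddGroup.mk_surjective x
    have hsub : curvatureSupport (supportFn K) ⊆
        {(θ : AddCircle (2 * π)), ((θ + π : ℝ) : AddCircle (2 * π))} := by
      intro y hy
      obtain ⟨θ', rfl⟩ := QuotientAddGroup.mk_surjective y
      exact coe_eq_or_eq_of_inner_unitVec_eq_zero (sub_ne_zero.2 hpq) (horth θ hx) (horth θ' hy)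
    refine (encard_le_encard hsub).trans ((encard_insert_le _ _).trans ?_)
    rw [encard_singleton]
    norm_num

/-- A triangle is not contained in a line. -/
theorem exists_inner_ne_of_affineIndependent {p : Fin 3 → Plane} (hp : AffineIndependent ℝ p)
    (θ : ℝ) (r : ℝ) : ∃ k, inner ℝ (p k) (unitVec θ) ≠ r := by
  by_contra! h
  rw [affineIndependent_iff_not_collinear] at hp
  refine hp ((collinear_iff_of_mem (mem_range_self 0)).2 ⟨unitVec (θ + π / 2), ?_⟩)
  rintro _ ⟨k, rfl⟩
  refine ⟨inner ℝ (p k - p 0) (unitVec (θ + π / 2)), ?_⟩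
  have h1 := (h k).trans (h 0).symm
  have h2 := Real.sin_sq_add_cos_sq θ
  rw [inner_unitVec, inner_unitVec] at h1
  rw [inner_unitVec]
  ext i
  fin_cases i
  · simp [unitVec, Real.cos_add, Real.sin_add]
    linear_combination (-(p k 0 - p 0 0)) * h2 + Real.cos θ * h1
  · simp [unitVec, Real.cos_add, Real.sin_add]
    linear_combination (-(p k 1 - p 0 1)) * h2 + Real.sin θ * h1

theorem encard_curvatureSupport_of_isTriangle {K : NonemptyCompacts Plane}
    (hK : IsTriangle (K : Set Plane)) : (curvatureSupport (supportFn K)).encard ≤ 3 := by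
  obtain ⟨p, hp, hK⟩ := hK
  set T : Fin 3 → Fin 3 → Set (AddCircle (2 * π)) := fun i j =>
    {x | ∃ θ : ℝ, (θ : AddCircle (2 * π)) = x ∧ inner ℝ (p i) (unitVec θ) = supportFn K θ ∧
      inner ℝ (p j) (unitVec θ) = supportFn K θ}
  have hT : ∀ i j, i ≠ j → (T i j).encard ≤ 1 := by
    intro i j hij
    rw [encard_le_one_iff]
    rintro _ _ ⟨θ, rfl, h1, h2⟩ ⟨θ', rfl, h3, h4⟩
    have hw : p i - p j ≠ 0 := sub_ne_zero.2 (hp.injective.ne hij)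
    rcases coe_eq_or_eq_of_inner_unitVec_eq_zero hw (by rw [inner_sub_left, h1, h2, sub_self])
      (by rw [inner_sub_left, h3, h4, sub_self]) with h | h
    · exact h.symm
    -- Two vertices extreme in opposite directions would put the triangle in a line.
    · exfalso
      have hle : ∀ θ k, inner ℝ (p k) (unitVec θ) ≤ supportFn K θ := fun θ =>
        (supportFn_convexHull_range_le_iff hK).1 le_rfl
      have he : unitVec θ' = -unitVec θ := by
        obtain ⟨k, hk⟩ := coe_addCircle_eq_iff.1 h
        rw [← unitVec_add_pi, ← unitVec_sub_zsmul θ' k, hk, add_sub_cancel_right]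
      obtain ⟨k, hk⟩ := exists_inner_ne_of_affineIndependent hp θ (inner ℝ (p i) (unitVec θ))
      have h5 := hle θ k
      have h6 := hle θ' k
      rw [← h3, he, inner_neg_right, inner_neg_right] at h6
      rw [← h1] at h5
      exact hk (le_antisymm h5 (by linarith))
  have hsub : curvatureSupport (supportFn K) ⊆ T 0 1 ∪ T 0 2 ∪ T 1 2 := by
    intro x hx
    obtain ⟨θ, rfl⟩ := QuotientAddGroup.mk_surjective x
    obtain ⟨i, j, hij, hi, hj⟩ := exists_tie_of_mem_curvatureSupport hK hx
    have hT' : ∀ i j, inner ℝ (p i) (unitVec θ) = supportFn K θ →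
      inner ℝ (p j) (unitVec θ) = supportFn K θ → (θ : AddCircle (2 * π)) ∈ T i j :=
      fun i j h1 h2 => ⟨θ, rfl, h1, h2⟩
    fin_cases i <;> fin_cases j <;> simp at hij
    · exact Or.inl (Or.inl (hT' _ _ hi hj))
    · exact Or.inl (Or.inr (hT' _ _ hi hj))
    · exact Or.inl (Or.inl (hT' _ _ hj hi))
    · exact Or.inr (hT' _ _ hi hj)
    · exact Or.inl (Or.inr (hT' _ _ hj hi))
    · exact Or.inr (hT' _ _ hj hi)
  calc (curvatureSupport (supportFn K)).encard ≤ (T 0 1 ∪ T 0 2 ∪ T 1 2).encard :=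
        encard_le_encard hsub
    _ ≤ (T 0 1).encard + (T 0 2).encard + (T 1 2).encard :=
        (encard_union_le _ _).trans (by gcongr; exact encard_union_le _ _)
    _ ≤ 1 + 1 + 1 := by gcongr <;> exact hT _ _ (by decide)
    _ = 3 := by norm_num

/-! ### Curvature carried by three points -/

theorem exists_abs_sub_zsmul_le_arccos {κ x : ℝ} (h : κ ≤ Real.cos x) :
    ∃ k : ℤ, |x - k • (2 * π)| ≤ Real.arccos κ := by
  obtain ⟨k, hk⟩ := exists_abs_sub_zsmul_sub_le_pi x 0
  rw [sub_zero] at hk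
  refine ⟨k, ?_⟩
  rw [← Real.arccos_cos (abs_nonneg _) hk, Real.cos_abs, Real.cos_periodic.sub_zsmul_eq]
  exact Real.antitone_arccos h

theorem eventually_arccos_lt {δ : ℝ} (hδ : 0 < δ) : ∀ᶠ κ in 𝓝[<] (1 : ℝ), Real.arccos κ < δ :=
  nhdsWithin_le_nhds (Real.continuous_arccos.continuousAt.eventually_lt
    continuousAt_const (by simpa using hδ))

/-- Off the support of the curvature, the mollifications `m` satisfy `m'' + m = 0`, because the
kernel at a nearby point is a test function supported off the support. -/
theorem exists_mollify_ode_of_notMem {h : ℝ → ℝ} (hc : Continuous h) {θ₀ : ℝ}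
    (hθ₀ : (θ₀ : AddCircle (2 * π)) ∉ curvatureSupport h) :
    ∃ δ > 0, ∀ᶠ κ in 𝓝[<] (1 : ℝ), ∀ θ ∈ Ioo (θ₀ - δ) (θ₀ + δ),
      periodicConv (iteratedDeriv 2 (periodicBump κ)) h θ + periodicConv (periodicBump κ) h θ
        = 0 := by
  simp only [curvatureSupport, mem_ofPred_eq] at hθ₀
  push Not at hθ₀
  obtain ⟨U, hU, hzero⟩ := hθ₀
  have hU' : (fun θ : ℝ => (θ : AddCircle (2 * π))) ⁻¹' U ∈ 𝓝 θ₀ :=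
    (AddCircle.continuous_mk' (2 * π)).continuousAt.preimage_mem_nhds hU
  obtain ⟨ε, hε, hball⟩ := Metric.mem_nhds_iff.1 hU'
  refine ⟨ε / 2, by positivity, ?_⟩
  filter_upwards [eventually_arccos_lt (half_pos hε), self_mem_nhdsWithin] with κ hκ hκ1 θ hθ
  have hsm := contDiff_periodicBump κ
  have hsm' : ContDiff ℝ ∞ fun s => periodicBump κ (θ - s) :=
    hsm.comp (contDiff_const.sub contDiff_id)
  have hper : Function.Periodic (fun s => periodicBump κ (θ - s)) (2 * π) := fun s => by
    simp only
    rw [← periodicBump_periodic κ (θ - (s + 2 * π))]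
    congr 1
    ring
  have hsupp : tsupport (fun s => periodicBump κ (θ - s)) ⊆
      (fun θ : ℝ => (θ : AddCircle (2 * π))) ⁻¹' U := by
    have h1 : tsupport (fun s => periodicBump κ (θ - s)) ⊆ {s | κ ≤ Real.cos (θ - s)} := by
      refine closure_minimal (fun s hs => ?_)
        (isClosed_le continuous_const (by fun_prop))
      by_contra hlt
      exact hs (periodicBump_eq_zero hκ1 (le_of_not_ge hlt))
    intro s hs
    obtain ⟨k, hk⟩ := exists_abs_sub_zsmul_le_arccos (h1 hs)
    have h2 : s + k • (2 * π) ∈ Metric.ball θ₀ ε := by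
      rw [Metric.mem_ball, Real.dist_eq, abs_lt]
      have h3 := abs_le.1 (hk.trans hκ.le)
      constructor <;> linarith [h3.1, h3.2, hθ.1, hθ.2]
    have h4 := hball h2
    rwa [mem_preimage, coe_addCircle_eq_iff.2 ⟨k, rfl⟩] at h4
  have := hzero _ hsm' hper hsupp
  rw [iteratedDeriv_comp_const_sub] at this
  have c1 := hsm.continuous
  have c2 := hsm.continuous_iteratedDeriv_two
  rw [periodicConv, periodicConv, ← intervalIntegral.integral_add
    ((by fun_prop : Continuous _).intervalIntegrable _ _)
    ((by fun_prop : Continuous _).intervalIntegrable _ _)]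
  refine Eq.trans (intervalIntegral.integral_congr fun s _ => ?_) this
  simp
  ring

/-- Solutions of `g'' + g = 0` on an interval are trigonometrically affine. -/
theorem sin_sub_mul_eq_of_ode {g g' g'' : ℝ → ℝ} (h1 : ∀ x, HasDerivAt g (g' x) x)
    (h2 : ∀ x, HasDerivAt g' (g'' x) x) {a b : ℝ} (h : ∀ x ∈ Ioo a b, g'' x + g x = 0)
    {α β θ : ℝ} (hα : α ∈ Ioo a b) (hβ : β ∈ Ioo a b) (hθ : θ ∈ Ioo a b) :
    Real.sin (β - α) * g θ = g α * Real.sin (β - θ) + g β * Real.sin (θ - α) := by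
  have hA : ∀ x, HasDerivAt (fun x => g x * Real.cos x - g' x * Real.sin x)
      (-(g'' x + g x) * Real.sin x) x := fun x => by
    refine (((h1 x).mul (Real.hasDerivAt_cos x)).sub
      ((h2 x).mul (Real.hasDerivAt_sin x))).congr_deriv ?_
    ring
  have hB : ∀ x, HasDerivAt (fun x => g x * Real.sin x + g' x * Real.cos x)
      ((g'' x + g x) * Real.cos x) x := fun x => by
    refine (((h1 x).mul (Real.hasDerivAt_sin x)).add
      ((h2 x).mul (Real.hasDerivAt_cos x))).congr_deriv ?_
    ring
  have hA' : ∀ x ∈ Ioo a b, g x * Real.cos x - g' x * Real.sin x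
      = g α * Real.cos α - g' α * Real.sin α := fun x hx =>
    isOpen_Ioo.is_const_of_deriv_eq_zero isPreconnected_Ioo
      (fun x _ => (hA x).differentiableAt.differentiableWithinAt)
      (fun x hx => by simp [(hA x).deriv, h x hx]) hx hα
  have hB' : ∀ x ∈ Ioo a b, g x * Real.sin x + g' x * Real.cos x
      = g α * Real.sin α + g' α * Real.cos α := fun x hx =>
    isOpen_Ioo.is_const_of_deriv_eq_zero isPreconnected_Ioo
      (fun x _ => (hB x).differentiableAt.differentiableWithinAt)
      (fun x hx => by simp [(hB x).deriv, h x hx]) hx hα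
  set A := g α * Real.cos α - g' α * Real.sin α
  set B := g α * Real.sin α + g' α * Real.cos α
  have hg : ∀ x ∈ Ioo a b, g x = A * Real.cos x + B * Real.sin x := fun x hx => by
    linear_combination Real.cos x * hA' x hx + Real.sin x * hB' x hx
      - g x * Real.sin_sq_add_cos_sq x
  rw [hg α hα, hg β hβ, hg θ hθ]
  simp only [Real.sin_sub]
  ring

/-- Near a point off the support of `h'' + h`, the function `h` is trigonometrically affine: the
interpolation identity for solutions of `m'' + m = 0` passes from the mollifications to `h`. -/
theorem exists_eventuallyEq_inner_of_notMem {h : ℝ → ℝ} (hc : Continuous h)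
    (hp : Function.Periodic h (2 * π)) {θ₀ : ℝ}
    (hθ₀ : (θ₀ : AddCircle (2 * π)) ∉ curvatureSupport h) :
    ∃ x : Plane, h =ᶠ[𝓝 θ₀] fun θ => inner ℝ x (unitVec θ) := by
  obtain ⟨δ, hδ, hev⟩ := exists_mollify_ode_of_notMem hc hθ₀
  -- Two nodes `θ₀` and `θ₀ + η` for the interpolation, less than `π` apart.
  set η := min (δ / 2) 1
  have hη : 0 < η := by positivity
  have hηδ : η < δ := (min_le_left _ _).trans_lt (by linarith)
  have hη1 : η ≤ 1 := min_le_right _ _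
  have hident : ∀ θ ∈ Ioo (θ₀ - δ) (θ₀ + δ), Real.sin (θ₀ + η - θ₀) * h θ
      = h θ₀ * Real.sin (θ₀ + η - θ) + h (θ₀ + η) * Real.sin (θ - θ₀) := by
    intro θ hθ
    refine tendsto_nhds_unique_of_eventuallyEq ((tendsto_mollify hc hp θ).const_mul _)
      (((tendsto_mollify hc hp θ₀).mul_const _).add
        ((tendsto_mollify hc hp (θ₀ + η)).mul_const _)) ?_
    filter_upwards [hev] with κ hκ
    refine sin_sub_mul_eq_of_ode (hasDerivAt_mollify κ hc) (hasDerivAt_deriv_mollify κ hc)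
      (a := θ₀ - δ) (b := θ₀ + δ) (fun x hx => ?_) ⟨by linarith, by linarith⟩
      ⟨by linarith, by linarith⟩ hθ
    rw [mollify, ← mul_add, hκ x hx, mul_zero]
  have hsin : 0 < Real.sin η :=
    Real.sin_pos_of_pos_of_lt_pi hη (hη1.trans_lt (by linarith [Real.pi_gt_three]))
  refine ⟨(Real.sin η)⁻¹ • !₂[h θ₀ * Real.sin (θ₀ + η) - h (θ₀ + η) * Real.sin θ₀,
    h (θ₀ + η) * Real.cos θ₀ - h θ₀ * Real.cos (θ₀ + η)], ?_⟩
  filter_upwards [Ioo_mem_nhds (by linarith : θ₀ - δ < θ₀) (by linarith : θ₀ < θ₀ + δ)] with θ hθ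
  have := hident θ hθ
  rw [add_sub_cancel_left] at this
  rw [real_inner_smul_left, inner_unitVec, eq_inv_mul_iff_mul_eq₀ hsin.ne', this]
  simp only [Real.sin_sub, Matrix.cons_val_zero, Matrix.cons_val_one]
  ring

theorem hasDerivAt_inner_unitVec (x : Plane) (θ : ℝ) :
    HasDerivAt (fun θ => inner ℝ x (unitVec θ)) (x 1 * Real.cos θ - x 0 * Real.sin θ) θ := by
  simp only [inner_unitVec]
  refine (((Real.hasDerivAt_cos θ).const_mul (x 0)).add
    ((Real.hasDerivAt_sin θ).const_mul (x 1))).congr_deriv ?_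
  ring

/-- A point is determined by the value and the derivative of its support function at one
direction. -/
theorem eq_of_inner_unitVec_le {x y : Plane} {θ₀ : ℝ}
    (hle : ∀ᶠ θ in 𝓝 θ₀, (inner ℝ y (unitVec θ) : ℝ) ≤ inner ℝ x (unitVec θ))
    (heq : (inner ℝ y (unitVec θ₀) : ℝ) = inner ℝ x (unitVec θ₀)) : y = x := by
  have hmin : IsLocalMin (fun θ => (inner ℝ x (unitVec θ) : ℝ) - inner ℝ y (unitVec θ)) θ₀ := by
    filter_upwards [hle] with θ hθ
    rw [heq, sub_self]
    linarith
  have h1 := hmin.hasDerivAt_eq_zero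
    ((hasDerivAt_inner_unitVec x θ₀).sub (hasDerivAt_inner_unitVec y θ₀))
  rw [inner_unitVec, inner_unitVec] at heq
  have h2 := Real.sin_sq_add_cos_sq θ₀
  ext i
  fin_cases i
  · simp only [Fin.zero_eta]
    linear_combination Real.cos θ₀ * heq + Real.sin θ₀ * h1 - (y 0 - x 0) * h2
  · simp only [Fin.mk_one]
    linear_combination Real.sin θ₀ * heq - Real.cos θ₀ * h1 - (y 1 - x 1) * h2

theorem mem_of_supportFn_eventuallyEq {K : NonemptyCompacts Plane} {x : Plane} {θ₀ : ℝ}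
    (h : supportFn K =ᶠ[𝓝 θ₀] fun θ => inner ℝ x (unitVec θ)) : x ∈ (K : Set Plane) := by
  obtain ⟨y, hy, he⟩ := exists_inner_eq_supportFn K θ₀
  have : y = x := eq_of_inner_unitVec_le (h.mono fun θ hθ => (inner_le_supportFn hy θ).trans_eq hθ)
    (he.trans h.eq_of_nhds)
  exact this ▸ hy

/-- On an arc free of curvature the support function is that of a single point of `K`. -/
theorem exists_mem_forall_Icc_supportFn_eq {K : NonemptyCompacts Plane} {α β : ℝ} (hαβ : α < β)
    (h : ∀ θ ∈ Ioo α β, (θ : AddCircle (2 * π)) ∉ curvatureSupport (supportFn K)) :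
    ∃ x ∈ (K : Set Plane), ∀ θ ∈ Icc α β, supportFn K θ = inner ℝ x (unitVec θ) := by
  have hloc : ∀ θ ∈ Ioo α β, ∃ x ∈ (K : Set Plane),
      supportFn K =ᶠ[𝓝 θ] fun θ => inner ℝ x (unitVec θ) := fun θ hθ => by
    obtain ⟨x, hx⟩ := exists_eventuallyEq_inner_of_notMem (continuous_supportFn K)
      (supportFn_periodic K) (h θ hθ)
    exact ⟨x, mem_of_supportFn_eventuallyEq hx, hx⟩
  choose! X hXK hX using hloc
  have hlc : ∀ θ ∈ Ioo α β, X =ᶠ[𝓝 θ] fun _ => X θ := by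
    intro θ hθ
    filter_upwards [(hX θ hθ).eventuallyEq_nhds, Ioo_mem_nhds hθ.1 hθ.2] with θ' h1 h2
    have h3 := (hX θ' h2).symm.trans h1
    exact eq_of_inner_unitVec_le (h3.mono fun _ => le_of_eq) h3.eq_of_nhds
  obtain ⟨θ₁, hθ₁⟩ := nonempty_Ioo.2 hαβ
  have hconst : ∀ θ ∈ Ioo α β, X θ = X θ₁ := fun θ hθ =>
    isOpen_Ioo.is_const_of_deriv_eq_zero (𝕜 := ℝ) isPreconnected_Ioo
      (fun θ hθ => ((hlc θ hθ).differentiableAt_iff.2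
        (differentiableAt_const _)).differentiableWithinAt)
      (fun θ hθ => by rw [(hlc θ hθ).deriv_eq]; simp) hθ hθ₁
  refine ⟨X θ₁, hXK θ₁ hθ₁, fun θ hθ => ?_⟩
  have heq : EqOn (supportFn K) (fun θ => inner ℝ (X θ₁) (unitVec θ)) (Ioo α β) := fun θ hθ => by
    rw [← hconst θ hθ]
    exact (hX θ hθ).eq_of_nhds
  have := heq.closure (continuous_supportFn K) (continuous_const.inner continuous_unitVec)
  rw [closure_Ioo hαβ.ne] at this
  exact this hθ

instance fact_two_pi_pos : Fact (0 < 2 * π) := ⟨Real.two_pi_pos⟩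

/-- The set is enlarged to exactly three points, so that they cut the circle into three
nondegenerate arcs. -/
theorem exists_lifts_of_encard_le_three {S : Set (AddCircle (2 * π))} (hS : S.encard ≤ 3) :
    ∃ t : Fin 3 → ℝ, StrictMono t ∧ (∀ i, t i ∈ Ico 0 (2 * π)) ∧
      ∀ x ∈ S, ∃ i, x = (t i : AddCircle (2 * π)) := by
  have hinf : (univ : Set (AddCircle (2 * π))).encard = ⊤ := by
    have : Infinite (AddCircle (2 * π)) := by
      have := (Ico_infinite (show (0 : ℝ) < 0 + 2 * π by linarith [Real.two_pi_pos])).to_subtype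
      exact Infinite.of_injective _ (AddCircle.equivIco (2 * π) 0).symm.injective
    exact infinite_univ.encard_eq
  obtain ⟨S', hSS', -, hS'⟩ := exists_superset_subset_encard_eq (subset_univ S) hS
    (by rw [hinf]; exact le_top)
  have hfin : S'.Finite := finite_of_encard_eq_coe (k := 3) hS'
  set f : AddCircle (2 * π) → ℝ := fun x => (AddCircle.equivIco (2 * π) 0 x : ℝ)
  have hf : ∀ x, ((f x : ℝ) : AddCircle (2 * π)) = x := fun x =>
    (AddCircle.equivIco (2 * π) 0).symm_apply_apply x
  have hfi : Function.Injective f := fun x y h => by rw [← hf x, h, hf]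
  have hcard : (hfin.toFinset.image f).card = 3 := by
    rw [Finset.card_image_of_injective _ hfi, ← Nat.cast_inj (R := ℕ∞),
      ← hfin.encard_eq_coe_toFinset_card, hS']
    rfl
  refine ⟨(hfin.toFinset.image f).orderEmbOfFin hcard,
    ((hfin.toFinset.image f).orderEmbOfFin hcard).strictMono, fun i => ?_, fun x hx => ?_⟩
  · obtain ⟨x, -, hx⟩ := Finset.mem_image.1 (Finset.orderEmbOfFin_mem _ hcard i)
    rw [← hx]
    simpa using (AddCircle.equivIco (2 * π) 0 x).2
  · have : f x ∈ Set.range ((hfin.toFinset.image f).orderEmbOfFin hcard) := by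
      rw [Finset.range_orderEmbOfFin]
      exact Finset.mem_coe.2 (Finset.mem_image_of_mem _ (hfin.mem_toFinset.2 (hSS' hx)))
    obtain ⟨i, hi⟩ := this
    exact ⟨i, by rw [hi, hf]⟩

/-- The three points are those whose support functions agree with that of `K` on the three arcs. -/
theorem exists_convexHull_range_eq_of_encard_le_three {K : NonemptyCompacts Plane}
    (hK : Convex ℝ (K : Set Plane)) (h : (curvatureSupport (supportFn K)).encard ≤ 3) :
    ∃ p : Fin 3 → Plane, (K : Set Plane) = convexHull ℝ (range p) := by
  obtain ⟨t, ht, htI, hS⟩ := exists_lifts_of_encard_le_three h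
  have h01 : t 0 < t 1 := ht (by decide)
  have h12 : t 1 < t 2 := ht (by decide)
  have hnot : ∀ θ, t 0 < θ → θ < t 0 + 2 * π → θ ≠ t 1 → θ ≠ t 2 →
      (θ : AddCircle (2 * π)) ∉ curvatureSupport (supportFn K) := by
    intro θ h1 h2 h3 h4 hmem
    obtain ⟨i, hi⟩ := hS _ hmem
    have hti : t i ∈ Ico (t 0) (t 0 + 2 * π) :=
      ⟨ht.monotone (Fin.zero_le i), by linarith [(htI i).2, (htI 0).1]⟩
    replace hi := (AddCircle.coe_eq_coe_iff_of_mem_Ico ⟨h1.le, h2⟩ hti).1 hi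
    fin_cases i
    · exact h1.ne' hi
    · exact h3 hi
    · exact h4 hi
  have h20 : t 2 < t 0 + 2 * π := by linarith [(htI 2).2, (htI 0).1]
  obtain ⟨x, hxK, hx⟩ := exists_mem_forall_Icc_supportFn_eq (K := K) h01 fun θ hθ =>
    hnot θ hθ.1 (by linarith [hθ.2]) hθ.2.ne (by linarith [hθ.2] : θ < t 2).ne
  obtain ⟨y, hyK, hy⟩ := exists_mem_forall_Icc_supportFn_eq (K := K) h12 fun θ hθ =>
    hnot θ (h01.trans hθ.1) (by linarith [hθ.2]) hθ.1.ne' hθ.2.ne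
  obtain ⟨z, hzK, hz⟩ := exists_mem_forall_Icc_supportFn_eq (K := K) h20 fun θ hθ =>
    hnot θ (by linarith [hθ.1]) hθ.2 (by linarith [hθ.1] : t 1 < θ).ne' hθ.1.ne'
  refine ⟨![x, y, z], ?_⟩
  have hcomp : IsCompact (convexHull ℝ (range ![x, y, z])) :=
    (finite_range ![x, y, z]).isCompact_convexHull ℝ
  have hne : (convexHull ℝ (range ![x, y, z])).Nonempty := (range_nonempty _).convexHull
  set L : NonemptyCompacts Plane := ⟨⟨_, hcomp⟩, hne⟩
  have hL : ∀ i, ![x, y, z] i ∈ (L : Set Plane) := fun i => subset_convexHull ℝ _ ⟨i, rfl⟩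
  refine Subset.antisymm (fun w hw => ?_) (convexHull_min ?_ hK)
  · refine mem_of_inner_le_supportFn (K := L) (convex_convexHull ℝ _) fun θ => ?_
    refine (inner_le_supportFn hw θ).trans ?_
    have hmod := toIcoMod_mem_Ico Real.two_pi_pos (t 0) θ
    rw [← (supportFn_periodic K).sub_zsmul_eq (toIcoDiv Real.two_pi_pos (t 0) θ),
      ← (supportFn_periodic L).sub_zsmul_eq (toIcoDiv Real.two_pi_pos (t 0) θ)]
    change supportFn K (toIcoMod Real.two_pi_pos (t 0) θ) ≤
      supportFn L (toIcoMod Real.two_pi_pos (t 0) θ)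
    rcases le_total (toIcoMod Real.two_pi_pos (t 0) θ) (t 1) with h1 | h1
    · rw [hx _ ⟨hmod.1, h1⟩]
      exact inner_le_supportFn (hL 0) _
    rcases le_total (toIcoMod Real.two_pi_pos (t 0) θ) (t 2) with h2 | h2
    · rw [hy _ ⟨h1, h2⟩]
      exact inner_le_supportFn (hL 1) _
    · rw [hz _ ⟨h2, hmod.2.le⟩]
      exact inner_le_supportFn (hL 2) _
  · rintro _ ⟨i, rfl⟩
    fin_cases i
    · exact hxK
    · exact hyK
    · exact hzK

theorem perimeter_eq_zero_of_eq_singleton {K : NonemptyCompacts Plane} {x : Plane}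
    (h : (K : Set Plane) = {x}) : perimeter K = 0 := by
  have : supportFn K = fun θ => x 0 * Real.cos θ + x 1 * Real.sin θ := by
    funext θ
    rw [supportFn, h, image_singleton, csSup_singleton, inner_unitVec]
  rw [perimeter, this, intervalIntegral.integral_add
    ((by fun_prop : Continuous _).intervalIntegrable _ _)
    ((by fun_prop : Continuous _).intervalIntegrable _ _)]
  simp

/-- Three collinear points span a segment. -/
theorem isTriangle_or_isLineSegment_of_eq_convexHull {K : NonemptyCompacts Plane}
    (hP : perimeter K ≠ 0) {p : Fin 3 → Plane} (hK : (K : Set Plane) = convexHull ℝ (range p)) :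
    IsTriangle (K : Set Plane) ∨ IsLineSegment (K : Set Plane) := by
  by_cases hp : AffineIndependent ℝ p
  · exact Or.inl ⟨p, hp, hK⟩
  right
  rw [affineIndependent_iff_not_collinear, not_not] at hp
  have hrange : range p = {p 0, p 1, p 2} := by
    ext x
    simp [Fin.exists_fin_succ, eq_comm]
  rw [hrange] at hp hK
  have hseg : ∀ x y z : Plane, Wbtw ℝ x y z → (K : Set Plane) = convexHull ℝ {x, y, z} →
      IsLineSegment (K : Set Plane) := by
    intro x y z hw hxyz
    have hKs : (K : Set Plane) = segment ℝ x z := by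
      rw [hxyz]
      refine Subset.antisymm (convexHull_min ?_ (convex_segment _ _)) ?_
      · rintro w (rfl | rfl | rfl)
        · exact left_mem_segment ℝ _ _
        · rw [← affineSegment_eq_segment]
          exact hw
        · exact right_mem_segment ℝ _ _
      · rw [← convexHull_pair]
        exact convexHull_mono (by rintro w (rfl | rfl) <;> simp)
    refine ⟨x, z, ?_, hKs⟩
    rintro rfl
    exact hP (perimeter_eq_zero_of_eq_singleton (hKs.trans (segment_same ℝ x)))
  rcases hp.wbtw_or_wbtw_or_wbtw with hw | hw | hw
  · exact hseg _ _ _ hw hK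
  · refine hseg _ _ _ hw (hK.trans ?_)
    congr 1
    ext
    simp
    tauto
  · refine hseg _ _ _ hw (hK.trans ?_)
    congr 1
    ext
    simp
    tauto

/-! ### Perturbations of a set with four points of curvature -/

theorem curvaturePairing_sum {ι : Type*} [Fintype ι] {h : ℝ → ℝ} (hh : Continuous h) (c : ι → ℝ)
    {f : ι → ℝ → ℝ} (hf : ∀ i, ContDiff ℝ ∞ (f i)) :
    curvaturePairing h (fun θ => ∑ i, c i * f i θ) = ∑ i, c i * curvaturePairing h (f i) := by
  have h1 : deriv (fun θ => ∑ i, c i * f i θ) = fun θ => ∑ i, c i * deriv (f i) θ :=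
    funext fun x => (HasDerivAt.fun_sum fun i _ =>
      ((hf i).hasDerivAt_deriv x).const_mul (c i)).deriv
  have h2 : iteratedDeriv 2 (fun θ => ∑ i, c i * f i θ)
      = fun θ => ∑ i, c i * iteratedDeriv 2 (f i) θ := by
    rw [iteratedDeriv_two_eq, h1]
    exact funext fun x => (HasDerivAt.fun_sum fun i _ =>
      ((hf i).hasDerivAt_iteratedDeriv_two x).const_mul (c i)).deriv
  simp only [curvaturePairing, h2, ← intervalIntegral.integral_const_mul]
  rw [← intervalIntegral.integral_finsetSum fun i _ => ?_]
  · refine intervalIntegral.integral_congr fun θ _ => ?_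
    rw [← Finset.sum_add_distrib, Finset.mul_sum]
    exact Finset.sum_congr rfl fun i _ => by ring
  · have c1 := (hf i).continuous
    have c2 := (hf i).continuous_iteratedDeriv_two
    exact (by fun_prop : Continuous _).intervalIntegrable _ _

theorem exists_cos_sub_lt_imp_mem {θ₀ : ℝ} {U : Set (AddCircle (2 * π))}
    (hU : U ∈ 𝓝 (θ₀ : AddCircle (2 * π))) :
    ∃ κ < 1, ∀ θ : ℝ, κ < Real.cos (θ - θ₀) → (θ : AddCircle (2 * π)) ∈ U := by
  have hU' : (fun θ : ℝ => (θ : AddCircle (2 * π))) ⁻¹' U ∈ 𝓝 θ₀ :=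
    (AddCircle.continuous_mk' (2 * π)).continuousAt.preimage_mem_nhds hU
  obtain ⟨ε, hε, hball⟩ := Metric.mem_nhds_iff.1 hU'
  obtain ⟨κ, h1, h2⟩ := ((eventually_arccos_lt hε).and self_mem_nhdsWithin).exists
  refine ⟨κ, h2, fun θ hθ => ?_⟩
  obtain ⟨k, hk⟩ := exists_abs_sub_zsmul_le_arccos hθ.le
  have h3 : θ - k • (2 * π) ∈ Metric.ball θ₀ ε := by
    rw [Metric.mem_ball, Real.dist_eq, sub_right_comm]
    exact hk.trans_lt h1
  rw [coe_addCircle_eq_iff.2 ⟨k, (sub_add_cancel θ (k • (2 * π))).symm⟩]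
  exact hball h3

/-- Test functions localised near finitely many points of the support, with cutoffs that
separate them. -/
theorem exists_localized_test_functions {ι : Type*} [Finite ι] {h : ℝ → ℝ}
    {x : ι → AddCircle (2 * π)} (hx : Function.Injective x) (hmem : ∀ i, x i ∈ curvatureSupport h) :
    ∃ φ ψ : ι → ℝ → ℝ, (∀ i, ContDiff ℝ ∞ (φ i) ∧ Function.Periodic (φ i) (2 * π) ∧
      curvaturePairing h (φ i) ≠ 0) ∧
      (∀ i, ContDiff ℝ ∞ (ψ i) ∧ Function.Periodic (ψ i) (2 * π)) ∧
      (∀ i θ, φ i θ * ψ i θ = φ i θ) ∧ ∀ i j, i ≠ j → ∀ θ, φ i θ * ψ j θ = 0 := by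
  choose t ht using fun i => QuotientAddGroup.mk_surjective (x i)
  obtain ⟨U, hU, hdisj⟩ := (finite_range x).t2_separation
  choose κ hκ1 hκ using fun i =>
    exists_cos_sub_lt_imp_mem (θ₀ := t i) (by
      rw [show ((t i : ℝ) : AddCircle (2 * π)) = x i from ht i]
      exact (hU (x i)).2.mem_nhds (hU (x i)).1)
  have hV : ∀ i, ((↑) : ℝ → AddCircle (2 * π)) '' {θ | (1 + κ i) / 2 < Real.cos (θ - t i)}
      ∈ 𝓝 (x i) := fun i =>
    (QuotientAddGroup.isOpenMap_coe _ (isOpen_lt continuous_const (by fun_prop))).mem_nhds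
      ⟨t i, by simp only [mem_ofPred_eq, sub_self, Real.cos_zero]; linarith [hκ1 i], ht i⟩
  choose φ hφ hφp hsupp hne using fun i => hmem i _ (hV i)
  have hcos : ∀ i θ, φ i θ ≠ 0 → (1 + κ i) / 2 < Real.cos (θ - t i) := by
    intro i θ hθ
    obtain ⟨θ', hθ', he⟩ := hsupp i (subset_tsupport _ hθ)
    obtain ⟨k, hk⟩ := coe_addCircle_eq_iff.1 he
    have h1 : θ - t i = θ' - t i - k • (2 * π) := by rw [hk]; ring
    rw [h1, Real.cos_periodic.sub_zsmul_eq]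
    exact hθ'
  refine ⟨φ, fun i θ => periodicBump (κ i) (θ - t i), fun i => ⟨hφ i, hφp i, hne i⟩,
    fun i => ⟨(contDiff_periodicBump _).comp (contDiff_id.sub contDiff_const), fun θ => ?_⟩,
    fun i θ => ?_, fun i j hij θ => ?_⟩
  · simp only
    rw [add_sub_right_comm, periodicBump_periodic]
  · by_cases h0 : φ i θ = 0
    · simp [h0]
    · simp only [periodicBump_eq_one (hκ1 i) (hcos i θ h0).le, mul_one]
  · by_cases h0 : φ i θ = 0
    · simp [h0]
    · refine mul_eq_zero_of_right _ (periodicBump_eq_zero (hκ1 j) ?_)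
      by_contra! hlt
      have h1 : (θ : AddCircle (2 * π)) ∈ U (x i) :=
        hκ i θ (by linarith [hcos i θ h0, hκ1 i])
      exact disjoint_left.1 (hdisj (mem_range_self i) (mem_range_self j) (hx.ne hij)) h1 (hκ j θ hlt)

/-- Four points leave room for a density orthogonal to `1`, `cos` and `sin`. -/
theorem exists_density {h : ℝ → ℝ} (hh : Continuous h) {x : Fin 4 → AddCircle (2 * π)}
    (hx : Function.Injective x) (hmem : ∀ i, x i ∈ curvatureSupport h) :
    ∃ φ ψ : ℝ → ℝ, ContDiff ℝ ∞ φ ∧ Function.Periodic φ (2 * π) ∧ ContDiff ℝ ∞ ψ ∧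
      Function.Periodic ψ (2 * π) ∧ curvaturePairing h (fun θ => φ θ * Real.cos θ) = 0 ∧
      curvaturePairing h (fun θ => φ θ * Real.sin θ) = 0 ∧ curvaturePairing h φ = 0 ∧
      curvaturePairing h (fun θ => φ θ * ψ θ) ≠ 0 := by
  obtain ⟨φ, ψ, hφ, hψ, hself, hother⟩ := exists_localized_test_functions hx hmem
  set w : Fin 3 → ℝ → ℝ := ![Real.cos, Real.sin, fun _ => 1]
  have hw : ∀ k, ContDiff ℝ ∞ (w k) := by
    intro k
    fin_cases k
    · exact Real.contDiff_cos
    · exact Real.contDiff_sin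
    · exact contDiff_const
  -- Three linear conditions on four coefficients have a nonzero solution.
  set A : Matrix (Fin 3) (Fin 4) ℝ := fun k i => curvaturePairing h (fun θ => φ i θ * w k θ)
  obtain ⟨c, hc, hc0⟩ := (Submodule.ne_bot_iff _).1
    (LinearMap.ker_ne_bot_of_finrank_lt (f := A.mulVecLin) (by simp))
  obtain ⟨j, hj⟩ := Function.ne_iff.1 hc0
  have hsum : ∀ u : ℝ → ℝ, ContDiff ℝ ∞ u → curvaturePairing h (fun θ => (∑ i, c i * φ i θ) * u θ)
      = ∑ i, c i * curvaturePairing h (fun θ => φ i θ * u θ) := by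
    intro u hu
    rw [← curvaturePairing_sum hh c fun i => (hφ i).1.mul hu]
    simp only [Finset.sum_mul, mul_assoc]
  have hzero : ∀ k, curvaturePairing h (fun θ => (∑ i, c i * φ i θ) * w k θ) = 0 := by
    intro k
    rw [hsum _ (hw k)]
    refine Eq.trans ?_ (congrFun (LinearMap.mem_ker.1 hc) k)
    exact Finset.sum_congr rfl fun i _ => mul_comm _ _
  refine ⟨fun θ => ∑ i, c i * φ i θ, ψ j,
    ContDiff.sum fun i _ => contDiff_const.mul (hφ i).1, fun θ => ?_, (hψ j).1, (hψ j).2,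
    hzero 0, hzero 1, by simpa [w] using hzero 2, ?_⟩
  · simp only [(hφ _).2.1 θ]
  · rw [hsum _ (hψ j).1, Finset.sum_eq_single j]
    · simp only [hself]
      exact mul_ne_zero hj (hφ j).2.2
    · intro i _ hij
      simp [hother i j hij, curvaturePairing]
    · simp

theorem TrigConvex.sub_inner_unitVec {g : ℝ → ℝ} (hg : TrigConvex g) (x : Plane) :
    TrigConvex fun θ => g θ - inner ℝ x (unitVec θ) := by
  intro θ s s' hs hs'
  have h1 := hg θ s s' hs hs'
  simp only [inner_unitVec, Real.cos_add, Real.sin_add, Real.cos_sub, Real.sin_sub] at h1 ⊢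
  linarith

theorem integral_inner_unitVec (x : Plane) :
    ∫ θ in (0 : ℝ)..(2 * π), inner ℝ x (unitVec θ) = 0 := by
  simp only [inner_unitVec]
  rw [intervalIntegral.integral_add
    ((by fun_prop : Continuous _).intervalIntegrable _ _)
    ((by fun_prop : Continuous _).intervalIntegrable _ _)]
  simp

theorem continuous_smul_unitVec {f : ℝ → ℝ} (hf : Continuous f) :
    Continuous fun θ => f θ • unitVec θ :=
  hf.smul continuous_unitVec

theorem integral_smul_unitVec_apply {f : ℝ → ℝ} (hf : Continuous f) (i : Fin 2) :
    (∫ θ in (0 : ℝ)..(2 * π), f θ • unitVec θ) i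
      = ∫ θ in (0 : ℝ)..(2 * π), f θ * unitVec θ i := by
  have hi : IntervalIntegrable (fun θ => f θ • unitVec θ) volume 0 (2 * π) :=
    (continuous_smul_unitVec hf).intervalIntegrable _ _
  exact ((EuclideanSpace.proj (𝕜 := ℝ) (ι := Fin 2)
    i).intervalIntegral_comp_comm hi).symm

/-- The Steiner point of a single point is that point. -/
theorem integral_inner_smul_unitVec (x : Plane) :
    ∫ θ in (0 : ℝ)..(2 * π), (inner ℝ x (unitVec θ) : ℝ) • unitVec θ = π • x := by
  have hc : Continuous fun θ => (inner ℝ x (unitVec θ) : ℝ) :=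
    continuous_const.inner continuous_unitVec
  have h0 : ∫ θ in (0 : ℝ)..(2 * π), (x 0 * Real.cos θ + x 1 * Real.sin θ) * Real.cos θ
      = π * x 0 := by
    have : ∀ θ, (x 0 * Real.cos θ + x 1 * Real.sin θ) * Real.cos θ
        = x 0 * Real.cos θ ^ 2 + x 1 * (Real.sin θ * Real.cos θ) := fun θ => by ring
    simp only [this]
    rw [intervalIntegral.integral_add
      ((by fun_prop : Continuous _).intervalIntegrable _ _)
      ((by fun_prop : Continuous _).intervalIntegrable _ _), intervalIntegral.integral_const_mul,
      intervalIntegral.integral_const_mul, integral_cos_sq, integral_sin_mul_cos₁]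
    simp
    ring
  have h1 : ∫ θ in (0 : ℝ)..(2 * π), (x 0 * Real.cos θ + x 1 * Real.sin θ) * Real.sin θ
      = π * x 1 := by
    have : ∀ θ, (x 0 * Real.cos θ + x 1 * Real.sin θ) * Real.sin θ
        = x 1 * Real.sin θ ^ 2 + x 0 * (Real.sin θ * Real.cos θ) := fun θ => by ring
    simp only [this]
    rw [intervalIntegral.integral_add
      ((by fun_prop : Continuous _).intervalIntegrable _ _)
      ((by fun_prop : Continuous _).intervalIntegrable _ _), intervalIntegral.integral_const_mul,
      intervalIntegral.integral_const_mul, integral_sin_sq, integral_sin_mul_cos₁]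
    simp
    ring
  ext i
  rw [integral_smul_unitVec_apply hc]
  simp only [inner_unitVec]
  fin_cases i
  · simpa [unitVec] using h0
  · simpa [unitVec] using h1

theorem curvaturePairing_one (h : ℝ → ℝ) :
    curvaturePairing h (fun _ => 1) = ∫ θ in (0 : ℝ)..(2 * π), h θ := by
  simp [curvaturePairing, iteratedDeriv_two_eq]

/-- A convex set whose curvature is carried by at least four points is the midpoint of a segment
of support functions with the same Steiner point and perimeter. -/
theorem exists_perturbation {K : NonemptyCompacts Plane}
    (hS : 3 < (curvatureSupport (supportFn K)).encard) :
    ∃ v : ℝ → ℝ, Continuous v ∧ Function.Periodic v (2 * π) ∧ v ≠ 0 ∧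
      ∫ θ in (0 : ℝ)..(2 * π), v θ = 0 ∧ ∫ θ in (0 : ℝ)..(2 * π), v θ • unitVec θ = 0 ∧
      ∃ ε > 0, ∀ t, |t| ≤ ε → ∃ L : NonemptyCompacts Plane, Convex ℝ (L : Set Plane) ∧
        ∀ θ, supportFn L θ = supportFn K θ + t * v θ := by
  obtain ⟨x, hx, hmem⟩ : ∃ x : Fin 4 → AddCircle (2 * π), Function.Injective x ∧
      ∀ i, x i ∈ curvatureSupport (supportFn K) := by
    obtain ⟨S, hS1, hS2⟩ := exists_subset_encard_eq (Order.add_one_le_of_lt hS)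
    have hfin : S.Finite := finite_of_encard_eq_coe (k := 4) (hS2.trans (by norm_num))
    have hcard : hfin.toFinset.card = 4 := by
      rw [← Nat.cast_inj (R := ℕ∞), ← hfin.encard_eq_coe_toFinset_card, hS2]
      norm_num
    refine ⟨fun i => (hfin.toFinset.equivFinOfCardEq hcard).symm i,
      Subtype.val_injective.comp (Equiv.injective _), fun i => hS1 ?_⟩
    exact hfin.mem_toFinset.1 ((hfin.toFinset.equivFinOfCardEq hcard).symm i).2
  have hc := continuous_supportFn K
  have hp := supportFn_periodic K
  obtain ⟨φ, ψ, hφ, hφp, hψ, hψp, hcos, hsin, hone, hne⟩ := exists_density hc hx hmem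
  set T := curvatureMul φ (supportFn K)
  have hTc : Continuous T := continuous_curvatureMul hφ hc
  have hTp : Function.Periodic T (2 * π) := curvatureMul_periodic hφ hφp hc hp hcos hsin
  -- Subtracting the support function of this point moves the Steiner point to the origin.
  set m : Plane := π⁻¹ • ∫ θ in (0 : ℝ)..(2 * π), T θ • unitVec θ
  have hmc : Continuous fun θ => (inner ℝ m (unitVec θ) : ℝ) :=
    continuous_const.inner continuous_unitVec
  have hmp : Function.Periodic (fun θ => (inner ℝ m (unitVec θ) : ℝ)) (2 * π) := fun θ => by
    simp only [unitVec_add_two_pi]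
  have hvc : Continuous fun θ => T θ - inner ℝ m (unitVec θ) := hTc.sub hmc
  have hvp : Function.Periodic (fun θ => T θ - inner ℝ m (unitVec θ)) (2 * π) := hTp.sub hmp
  obtain ⟨M, hM⟩ := hφp.exists_abs_le hφ.continuous
  have hM0 : 0 ≤ M := (abs_nonneg _).trans (hM 0)
  refine ⟨fun θ => T θ - inner ℝ m (unitVec θ), hvc, hvp, fun h0 => hne ?_, ?_, ?_,
    (M + 1)⁻¹, by positivity, fun t ht => ?_⟩
  · have hT : T = fun θ => inner ℝ m (unitVec θ) := funext fun θ => sub_eq_zero.1 (congrFun h0 θ)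
    rw [← curvaturePairing_curvatureMul hφ hc hcos hsin hψ]
    change curvaturePairing T ψ = 0
    rw [hT]
    exact curvaturePairing_inner_unitVec m hψ hψp
  · rw [intervalIntegral.integral_sub (hTc.intervalIntegrable _ _) (hmc.intervalIntegrable _ _),
      integral_inner_unitVec, ← curvaturePairing_one,
      curvaturePairing_curvatureMul hφ hc hcos hsin contDiff_const]
    simpa using hone
  · simp only [sub_smul]
    rw [intervalIntegral.integral_sub ((continuous_smul_unitVec hTc).intervalIntegrable _ _)
      ((continuous_smul_unitVec hmc).intervalIntegrable _ _), integral_inner_smul_unitVec,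
      smul_inv_smul₀ Real.pi_ne_zero, sub_self]
  -- `h + t v` has curvature `(1 + t φ) (h'' + h)`, up to the support function of a point.
  · have hnn : ∀ θ, 0 ≤ 1 + t * φ θ := by
      intro θ
      have h1 : |t * φ θ| ≤ 1 := by
        rw [abs_mul]
        calc |t| * |φ θ| ≤ (M + 1)⁻¹ * (M + 1) :=
              mul_le_mul ht ((hM θ).trans (by linarith)) (abs_nonneg _) (by positivity)
          _ = 1 := inv_mul_cancel₀ (by positivity)
      linarith [(abs_le.1 h1).1]
    have htc := (trigConvex_curvatureMul K (contDiff_const.add (contDiff_const.mul hφ))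
      hnn).sub_inner_unitVec (t • m)
    have hg : (fun θ => curvatureMul (fun θ => 1 + t * φ θ) (supportFn K) θ
        - inner ℝ (t • m) (unitVec θ))
        = fun θ => supportFn K θ + t * (T θ - inner ℝ m (unitVec θ)) := by
      funext θ
      rw [curvatureMul_one_add hφ, real_inner_smul_left]
      ring
    rw [hg] at htc
    obtain ⟨L, hL, hLg⟩ := htc.exists_supportFn_eq (by fun_prop) fun θ => by
      simp only [hp θ, hvp θ]
    exact ⟨L, hL, congrFun hLg⟩

theorem mem_classA_of_supportFn_eq {K L : NonemptyCompacts Plane} (hK : K ∈ classA)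
    (hL : Convex ℝ (L : Set Plane)) {v : ℝ → ℝ} (hv : Continuous v)
    (hv0 : ∫ θ in (0 : ℝ)..(2 * π), v θ = 0)
    (hv1 : ∫ θ in (0 : ℝ)..(2 * π), v θ • unitVec θ = 0) {t : ℝ}
    (h : ∀ θ, supportFn L θ = supportFn K θ + t * v θ) : L ∈ classA := by
  have hc := continuous_supportFn K
  refine ⟨hL, ?_, ?_⟩
  · have hvt : Continuous fun θ => t • v θ • unitVec θ :=
      (continuous_smul_unitVec hv).const_smul t
    rw [← hK.2.1]
    simp only [steinerPoint, h, add_smul, mul_smul]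
    rw [intervalIntegral.integral_add ((continuous_smul_unitVec hc).intervalIntegrable _ _)
      (hvt.intervalIntegrable _ _),
      intervalIntegral.integral_smul, hv1, smul_zero, add_zero]
  · rw [← hK.2.2]
    simp only [perimeter, h]
    rw [intervalIntegral.integral_add (hc.intervalIntegrable _ _)
      ((hv.const_mul t).intervalIntegrable _ _),
      intervalIntegral.integral_const_mul, hv0, mul_zero, add_zero]

/-- Otherwise `K` is the midpoint of two members of `𝒜` arbitrarily close to it, against strict
convexity of the functional along the segment. -/
theorem encard_curvatureSupport_le_of_isLocalMaxOn {a b c d : ℝ → ℝ}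
    (ha : MemLp a ∞ (volume.restrict (Ioc 0 (2 * π))))
    (hb : MemLp b ∞ (volume.restrict (Ioc 0 (2 * π))))
    (hc : MemLp c ∞ (volume.restrict (Ioc 0 (2 * π))))
    (hd : MemLp d ∞ (volume.restrict (Ioc 0 (2 * π))))
    (ha0 : ∀ᵐ θ ∂(volume.restrict (Ioc 0 (2 * π))), 0 ≤ a θ)
    (hb0 : ∀ᵐ θ ∂(volume.restrict (Ioc 0 (2 * π))), 0 ≤ b θ)
    (hpos : (∀ᵐ θ ∂(volume.restrict (Ioc 0 (2 * π))), 0 < a θ) ∨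
      (∀ᵐ θ ∂(volume.restrict (Ioc 0 (2 * π))), 0 < b θ))
    {K : NonemptyCompacts Plane} (hK : K ∈ classA)
    (hmax : IsLocalMaxOn (functionalJ a b c d) classA K) :
    (curvatureSupport (supportFn K)).encard ≤ 3 := by
  by_contra! hS
  obtain ⟨v, hv, hvp, hvne, hv0, hv1, ε, hε, hpert⟩ := exists_perturbation hS
  obtain ⟨M, hM⟩ := hvp.exists_abs_le hv
  have hM0 : 0 ≤ M := (abs_nonneg _).trans (hM 0)
  obtain ⟨δ, hδ, hball⟩ := Metric.mem_nhdsWithin_iff.1 hmax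
  set t := min ε (δ / (M + 1) / 2)
  have ht : 0 < t := by positivity
  have htM : t * M < δ := by
    calc t * M ≤ δ / (M + 1) / 2 * M := mul_le_mul_of_nonneg_right (min_le_right _ _) hM0
      _ < δ := by
        rw [div_div, div_mul_eq_mul_div, div_lt_iff₀ (by positivity)]
        nlinarith
  have hle : ∀ s, |s| = t → ∃ L ∈ classA, (∀ θ, supportFn L θ = supportFn K θ + s * v θ) ∧
      functionalJ a b c d L ≤ functionalJ a b c d K := by
    intro s hs
    obtain ⟨L, hL, hLs⟩ := hpert s (hs.trans_le (min_le_left _ _))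
    have hLA := mem_classA_of_supportFn_eq hK hL hv hv0 hv1 hLs
    refine ⟨L, hLA, hLs, hball ⟨?_, hLA⟩⟩
    refine (dist_le_of_supportFn_le hL hK.1 (by positivity) fun θ => ?_).trans_lt htM
    rw [hLs, add_sub_cancel_left, abs_mul, hs]
    exact mul_le_mul_of_nonneg_left (hM θ) ht.le
  obtain ⟨K₁, hK₁, h1, hJ1⟩ := hle t (abs_of_pos ht)
  obtain ⟨K₂, hK₂, h2, hJ2⟩ := hle (-t) (by rw [abs_neg, abs_of_pos ht])
  have := two_mul_functionalJ_lt ha hb hc hd ha0 hb0 hpos (K := K) (K₁ := K₁) (K₂ := K₂)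
    (fun θ => by rw [h1, h2]; ring) (hK₁.2.2.trans hK₂.2.2.symm) fun he => hvne <| funext fun θ => by
      have h3 := congrFun he θ
      rw [h1, h2] at h3
      exact (mul_eq_zero.1 (by linarith : t * v θ = 0)).resolve_left ht.ne'
  linarith

end

theorem mainTheorem1 (a b c d : ℝ → ℝ)
    (ha : MemLp a ∞ (volume.restrict (Ioc 0 (2 * π))))
    (hb : MemLp b ∞ (volume.restrict (Ioc 0 (2 * π))))
    (hc : MemLp c ∞ (volume.restrict (Ioc 0 (2 * π))))
    (hd : MemLp d ∞ (volume.restrict (Ioc 0 (2 * π))))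
    (ha0 : ∀ᵐ θ ∂(volume.restrict (Ioc 0 (2 * π))), 0 ≤ a θ)
    (hb0 : ∀ᵐ θ ∂(volume.restrict (Ioc 0 (2 * π))), 0 ≤ b θ)
    (hpos : (∀ᵐ θ ∂(volume.restrict (Ioc 0 (2 * π))), 0 < a θ) ∨
      (∀ᵐ θ ∂(volume.restrict (Ioc 0 (2 * π))), 0 < b θ)) :
    (∀ K ∈ classA, IsLocalMaxOn (functionalJ a b c d) classA K →
      (IsTriangle (K : Set Plane) ∨ IsLineSegment (K : Set Plane)) ∧
        (curvatureSupport (supportFn K)).encard ≤ 3) ∧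
    (∀ K ∈ classA, (IsTriangle (K : Set Plane) ∨ IsLineSegment (K : Set Plane)) ↔
      (curvatureSupport (supportFn K)).encard ≤ 3) := by
  have hequiv : ∀ K ∈ classA, (IsTriangle (K : Set Plane) ∨ IsLineSegment (K : Set Plane)) ↔
      (curvatureSupport (supportFn K)).encard ≤ 3 := by
    intro K hK
    refine ⟨fun h => h.elim encard_curvatureSupport_of_isTriangle
      encard_curvatureSupport_of_isLineSegment, fun h => ?_⟩
    obtain ⟨p, hp⟩ := exists_convexHull_range_eq_of_encard_le_three hK.1 h
    refine isTriangle_or_isLineSegment_of_eq_convexHull ?_ hp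
    rw [hK.2.2]
    exact Real.two_pi_pos.ne'
  refine ⟨fun K hK hmax => ?_, hequiv⟩
  have h := encard_curvatureSupport_le_of_isLocalMaxOn ha hb hc hd ha0 hb0 hpos hK hmax
  exact ⟨(hequiv K hK).2 h, h⟩
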